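/- For a power series $A(x)=\sum_{k\ge 0}a_kx^k$ let $H_n(A(x))=\det(a_{i+j})_{0\le i,j\le n-1}$ be its Hankel determinants, with $H_0(A(x))=1$. Let $M(x)=\sum_{m\ge 0}M_mx^m$ be the generating function of the Motzkin numbers $M_m=\sum_{k\ge 0}\binom{m}{2k}C_k$, where $C_k=\frac{1}{k+1}\binom{2k}{k}$ are the Catalan numbers, and write $H_m=H_m(M(x)^7)$. Then for every integer $n\ge 0$: \begin{align*} H_{21n}=H_{21n+1} &= (-1)^n,\\ H_{21n+2} &= (-1)^{n+1}\tfrac{7}{30}(2n+1)(374556n^4+385532n^3+127449n^2+13363n+60),\\ H_{21n+3} &= (-1)^n\tfrac{49}{180}(29647548n^6+54252996n^5+27993259n^4+2344748n^3-1393217n^2-227934n-1080)(2n+1)^2,\\ H_{21n+4} &= (-1)^{n+1}\tfrac{343}{180}(2n+1)^3(4235364n^6+12706092n^5+12161065n^4+3145310n^3-906059n^2-361032n+3420),\\ H_{21n+5} &= (-1)^{n+1}\tfrac{49}{180}(29647548n^6+123632292n^5+201441499n^4+160049288n^3+61715353n^2+9000600n-123300)(2n+1)^2,\\ H_{21n+6}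 &= (-1)^{n+1}\tfrac{7}{30}(374556n^4+1112692n^3+1218189n^2+583163n+103170)(2n+1),\\ H_{21n+7}=H_{21n+8} &= (-1)^{n+1},\\ H_{21n+9} &= (-1)^n\tfrac{7}{30}(n+1)(749112n^4+1850828n^3+1698242n^2+686273n+103230),\\ H_{21n+10} &= (-1)^{n+1}\tfrac{49}{180}(n+1)^2(118590192n^6+375938976n^5+459474568n^4+261223312n^3+59779951n^2-1682814n-1959840),\\ H_{21n+11} &= (-1)^n\tfrac{343}{90}(n+1)^3(16941456n^6+84707280n^5+148881208n^4+115228792n^3+34672057n^2-1047963n-1697400),\\ H_{21n+12} &= (-1)^n\tfrac{2401}{15}(n+1)^4(115248n^4+460992n^3+587608n^2+288512n+43695),\\ H_{21n+13} &= (-1)^n537824\,(n+1)^5,\\ H_{21n+14}=H_{21n+15} &= 0,\\ H_{21n+16} &= (-1)^{n+1}537824\,(n+1)^5,\\ H_{21n+17} &= (-1)^n\tfrac{2401}{15}(n+1)^4(115248n^4+460992n^3+587608n^2+217952n-26865),\\ H_{21n+18} &= (-1)^{n+1}\tfrac{343}{90}(n+1)^3(16941456n^6+118590192n^5+318295768n^4+398162632n^3+205815337n^2-2633505n-27024030),\\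 H_{21n+19} &= (-1)^{n+1}\tfrac{49}{180}(n+1)^2(118590192n^6+1047143328n^5+3815496328n^4+7351444912n^3+7906357711n^2+4503507834n+1062057240),\\ H_{21n+20} &= (-1)^{n+1}\tfrac{7}{30}(n+1)(749112n^4+4142068n^3+8571962n^2+7868343n+2702820). \end{align*} -/

import Mathlib

/-- The Hankel determinant `H_n(A(x)) = det (a_{i+j})_{0 ≤ i,j ≤ n-1}` of a power series
`A(x) = ∑ a_k x^k`; for `n = 0` it is the empty determinant `1`. -/
noncomputable def hankelDet {R : Type*} [CommRing R] (A : PowerSeries R) (n : ℕ) : R :=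
  Matrix.det (Matrix.of fun i j : Fin n => PowerSeries.coeff ((i : ℕ) + (j : ℕ)) A)

/-- The Motzkin numbers `M_n = ∑_{k ≥ 0} binom(n, 2k) C_k`, with `C_k` the Catalan numbers
(the terms with `k > n` vanish). -/
def motzkin (n : ℕ) : ℕ :=
  ∑ k ∈ Finset.range (n + 1), n.choose (2 * k) * catalan k

/-- The generating function `M(x) = ∑_{n ≥ 0} M_n x^n` of the Motzkin numbers, over `ℚ`. -/
noncomputable def motzkinSeries : PowerSeries ℚ :=
  PowerSeries.mk fun n => (motzkin n : ℚ)

/-! Write `L` for the functional with the Motzkin numbers as moments and `p_j` for its monic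
orthogonal polynomials, `p_{j+2} = (X - 1) p_{j+1} - p_j`. The equation `M = 1 + xM + x²M²` gives
`L(X^k p_j) = [x^k] x^j M^(j+1)`, so the coefficients of `M^7` are the moments of `L` against the
weight `w = X^6 p_6`.

The size of the determinant is then reduced from `N` to 6 (`hankelDet_motzkinSeries_pow_seven`). The
`N` polynomials `X^j w` are completed by 12 further ones to a family of polynomials of degree below
`N + 12`: six consecutive `p_{7m+7}, ..., p_{7m+12}`, and six shifts of `p_{7m+6}` and `p_{7m+13}`.
The determinant of its coefficient matrix is computed twice. (1) Pairing with `p_0, ..., p_{N+11}`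
is unitriangular on monomials. The 12 added columns are orthogonal to all `p_i` with `i < N` and
contribute a block of determinant 1, leaving the Hankel determinant. (2) Taking residues modulo
`p_6`, the coefficients 0 to 5, and the coefficients from 12 on has determinant 1 on a suitable
monic basis. Since `p_6` divides `w` and every `p_{7m+6}`, and `X^6` divides `w`, the matrix is
block triangular. The residues of `p_{7m+7}, ..., p_{7m+12}` contribute `(-1)^(m+1)`, the multiples
of `w` contribute 1, and what is left is a 6 × 6 determinant in the low coefficients of `p_{7m+6}`
and `p_{7m+13}`.

At `X = 0` the recurrence has characteristic polynomial `t² + t + 1`, with roots of order 3. Hence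
low coefficients of `p_n` are polynomial in `n` on each class modulo 3 (`lowCoeffs_motzkinOrtho`).
Together with the step 7 of the reduction this yields period 21, and each formula becomes a
polynomial identity. -/

/-- The determinant of the leading `n × n` section of an infinite matrix. -/
def natDet {K : Type*} [CommRing K] (n : ℕ) (F : ℕ → ℕ → K) : K :=
  Matrix.det (Matrix.of fun i j : Fin n => F i j)

/-! ### Block, triangular and change-of-basis rules for determinants. -/

section NatDet

open Polynomial

variable {K : Type*} [CommRing K]

lemma natDet_congr {n : ℕ} {F G : ℕ → ℕ → K} (h : ∀ i < n, ∀ j < n, F i j = G i j) :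
    natDet n F = natDet n G := by
  unfold natDet
  congr 1
  ext i j
  exact h i i.2 j j.2

lemma natDet_transpose (n : ℕ) (F : ℕ → ℕ → K) :
    natDet n (fun i j => F j i) = natDet n F := by
  unfold natDet
  rw [← Matrix.det_transpose]
  rfl

lemma natDet_add_of_upper_right_zero {N d : ℕ} {F : ℕ → ℕ → K}
    (h : ∀ i < N, ∀ j < d, F i (N + j) = 0) :
    natDet (N + d) F = natDet N F * natDet d (fun i j => F (N + i) (N + j)) := by
  unfold natDet
  rw [← Matrix.det_submatrix_equiv_self finSumFinEquiv, ← Matrix.det_fromBlocks_zero₁₂ _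
    (Matrix.of fun (i : Fin d) (j : Fin N) => F (N + i) j)]
  congr 1
  ext (i | i) (j | j) <;> simp [h]

lemma natDet_add_of_lower_left_zero {N d : ℕ} {F : ℕ → ℕ → K}
    (h : ∀ i < d, ∀ j < N, F (N + i) j = 0) :
    natDet (N + d) F = natDet N F * natDet d (fun i j => F (N + i) (N + j)) := by
  rw [← natDet_transpose, natDet_add_of_upper_right_zero (fun i hi j hj => h j hj i hi),
    natDet_transpose, natDet_transpose d (fun i j => F (N + i) (N + j))]

lemma natDet_lower_unitriangular {n : ℕ} {F : ℕ → ℕ → K}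
    (h : ∀ i < n, ∀ j < n, i < j → F i j = 0) (h1 : ∀ i < n, F i i = 1) : natDet n F = 1 := by
  induction n with
  | zero => simp [natDet]
  | succ n ih =>
    rw [natDet_add_of_upper_right_zero, ih]
    · simp [natDet, h1]
    · intro i hi j hj hij
      exact h i (by omega) j (by omega) hij
    · intro i hi
      exact h1 i (by omega)
    · intro i hi j hj
      exact h i (by omega) _ (by omega) (by omega)

lemma natDet_upper_unitriangular {n : ℕ} {F : ℕ → ℕ → K}
    (h : ∀ i < n, ∀ j < n, j < i → F i j = 0) (h1 : ∀ i < n, F i i = 1) : natDet n F = 1 := by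
  rw [← natDet_transpose]
  exact natDet_lower_unitriangular (fun i hi j hj hij => h j hj i hi hij) h1

/-- A cyclic shift of the columns by an even amount is the square of a cyclic shift, hence an even
permutation. -/
lemma natDet_rotate {p q : ℕ} (hq : Even q) (F : ℕ → ℕ → K) :
    natDet (p + q) (fun i j => F i (if j < p then j + q else j - p)) = natDet (p + q) F := by
  rcases Nat.eq_zero_or_pos (p + q) with h0 | h0
  · obtain ⟨rfl, rfl⟩ : p = 0 ∧ q = 0 := by omega
    simp [natDet]
  obtain ⟨c, rfl⟩ := hq
  have : NeZero (p + (c + c)) := ⟨by omega⟩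
  let r : Fin (p + (c + c)) := Fin.ofNat _ c
  let τ : Equiv.Perm (Fin (p + (c + c))) := Equiv.addRight r * Equiv.addRight r
  have hs : Equiv.Perm.sign τ = 1 := by
    simp only [τ, map_mul]
    exact Int.units_mul_self _
  have := Matrix.det_permute' τ (Matrix.of fun i j : Fin (p + (c + c)) => F i j)
  rw [hs] at this
  simp only [Units.val_one, Int.cast_one, one_mul] at this
  unfold natDet
  rw [← this]
  congr 1
  ext i j
  simp only [Matrix.of_apply, Matrix.submatrix_apply, id]
  congr 1
  have hj := j.2
  simp only [τ, r, Equiv.Perm.mul_apply, Equiv.coe_addRight, Fin.val_add, Fin.val_ofNat]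
  simp only [Nat.add_mod_mod, Nat.mod_add_mod]
  split_ifs with h
  · rw [Nat.mod_eq_of_lt] <;> omega
  · rw [Nat.mod_eq_sub_mod (by omega), Nat.mod_eq_of_lt] <;> omega

/-- Expanding each polynomial in monomials factors the matrix. The second factor does not involve
`φ`, so two families of functionals can be compared on the same polynomials. -/
lemma natDet_linear_apply {n : ℕ} (φ : ℕ → K[X] →ₗ[K] K) (p : ℕ → K[X])
    (hp : ∀ j < n, (p j).natDegree < n) :
    natDet n (fun i j => φ i (p j)) =
      natDet n (fun i k => φ i (X ^ k)) * natDet n (fun k j => (p j).coeff k) := by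
  unfold natDet
  rw [← Matrix.det_mul]
  congr 1
  ext i j
  simp only [Matrix.mul_apply, Matrix.of_apply]
  conv_lhs => rw [(p j).as_sum_range_C_mul_X_pow' (hp j j.2)]
  rw [map_sum, Finset.sum_range]
  refine Finset.sum_congr rfl fun k _ => ?_
  rw [← smul_eq_C_mul, map_smul, smul_eq_mul, mul_comm]

lemma natDet_linear_apply_monic {n : ℕ} (φ : ℕ → K[X] →ₗ[K] K) (p : ℕ → K[X])
    (hp : ∀ j, (p j).Monic) (hd : ∀ j, (p j).natDegree = j) :
    natDet n (fun i j => φ i (p j)) = natDet n (fun i k => φ i (X ^ k)) := by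
  rw [natDet_linear_apply φ p (fun j hj => by rwa [hd]),
    natDet_upper_unitriangular (F := fun k j => (p j).coeff k), mul_one]
  · intro i _ j _ hij
    exact coeff_eq_zero_of_natDegree_lt (by rwa [hd])
  · intro i _
    have := (hp i).coeff_natDegree
    rwa [hd] at this

end NatDet

/-! ### Motzkin generating function and its orthogonal polynomials. -/

section Motzkin

open Polynomial

open PowerSeries in
lemma coeff_geometric_mul_pow (n k : ℕ) :
    PowerSeries.coeff n ((PowerSeries.mk 1 : PowerSeries ℚ) *
      (PowerSeries.X ^ 2 * (PowerSeries.mk 1 : PowerSeries ℚ) ^ 2) ^ k) =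
      (n.choose (2 * k) : ℚ) := by
  have h : (PowerSeries.mk 1 : PowerSeries ℚ) *
      (PowerSeries.X ^ 2 * (PowerSeries.mk 1 : PowerSeries ℚ) ^ 2) ^ k =
      PowerSeries.X ^ (2 * k) * (PowerSeries.mk 1 : PowerSeries ℚ) ^ (2 * k + 1) := by
    rw [mul_pow, ← pow_mul, ← pow_mul]
    ring
  rw [h, mk_one_pow_eq_mk_choose_add, PowerSeries.coeff_X_pow_mul']
  split_ifs with hk
  · rw [coeff_mk, Nat.add_sub_cancel' hk]
  · rw [Nat.choose_eq_zero_of_lt (by omega), Nat.cast_zero]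

open PowerSeries in
-- This is `M(x) = (1 - x)⁻¹ C(x² / (1 - x)²)`, with `C` the Catalan series; it transfers the
-- quadratic equation of `C` to `M`.
lemma motzkinSeries_eq_subst :
    motzkinSeries = (PowerSeries.mk 1 : PowerSeries ℚ) *
      (catalanSeries.map (Nat.castRingHom ℚ)).subst
        (PowerSeries.X ^ 2 * PowerSeries.mk 1 ^ 2 : PowerSeries ℚ) := by
  set b : PowerSeries ℚ := PowerSeries.X ^ 2 * PowerSeries.mk 1 ^ 2 with hb
  have hs : HasSubst b := HasSubst.of_constantCoeff_zero' (by simp [hb])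
  -- The order of `b ^ k` is at least `2k`; the weaker bound `k` suffices to cut the sum at `n`, as
  -- in the definition of `motzkin`.
  have hz : ∀ j k : ℕ, j < k → coeff j (b ^ k) = 0 := by
    intro j k hjk
    have hd : (PowerSeries.X : PowerSeries ℚ) ^ k ∣ b ^ k :=
      pow_dvd_pow_of_dvd (Dvd.intro (PowerSeries.X * PowerSeries.mk 1 ^ 2) (by rw [hb]; ring)) k
    exact PowerSeries.X_pow_dvd_iff.mp hd j hjk
  ext n
  have hc : ∀ j ≤ n, coeff j ((catalanSeries.map (Nat.castRingHom ℚ)).subst b) =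
      ∑ k ∈ Finset.range (n + 1), (catalan k : ℚ) * coeff j (b ^ k) := by
    intro j hj
    rw [coeff_subst' hs, finsum_eq_sum_of_support_subset (s := Finset.range (n + 1))]
    · simp
    · intro k hk
      by_contra hkn
      apply hk
      rw [Finset.coe_range, Set.mem_Iio, not_lt] at hkn
      simp [hz j k (by omega)]
  have hp : ∀ p ∈ Finset.HasAntidiagonal.antidiagonal n, coeff p.1 (PowerSeries.mk 1 : PowerSeries ℚ) *
      coeff p.2 ((catalanSeries.map (Nat.castRingHom ℚ)).subst b) =
      ∑ k ∈ Finset.range (n + 1), coeff p.1 (PowerSeries.mk 1 : PowerSeries ℚ) *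
        ((catalan k : ℚ) * coeff p.2 (b ^ k)) := by
    intro p hp
    rw [hc p.2 (Finset.HasAntidiagonal.mem_antidiagonal.mp hp ▸ Nat.le_add_left _ _), Finset.mul_sum]
  rw [PowerSeries.coeff_mul, Finset.sum_congr rfl hp, Finset.sum_comm]
  simp only [motzkinSeries, motzkin, coeff_mk, Nat.cast_sum, Nat.cast_mul]
  refine Finset.sum_congr rfl fun k _ => ?_
  rw [← coeff_geometric_mul_pow, PowerSeries.coeff_mul, Finset.sum_mul]
  refine Finset.sum_congr rfl fun p _ => ?_
  rw [← hb, PowerSeries.coeff_mk]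
  ring

open PowerSeries in
/-- The functional equation `M = 1 + x M + x² M²`. -/
lemma motzkinSeries_functional_equation :
    motzkinSeries = 1 + PowerSeries.X * motzkinSeries + PowerSeries.X ^ 2 * motzkinSeries ^ 2 := by
  set b : PowerSeries ℚ := PowerSeries.X ^ 2 * PowerSeries.mk 1 ^ 2 with hb
  have hs : HasSubst b := HasSubst.of_constantCoeff_zero' (by simp [hb])
  have hC := congrArg (PowerSeries.map (Nat.castRingHom ℚ)) catalanSeries_sq_mul_X_add_one
  rw [map_add, map_mul, map_pow, PowerSeries.map_X, map_one] at hC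
  have hC' := congrArg (substAlgHom hs) hC
  rw [map_add, map_mul, map_pow, substAlgHom_X, map_one] at hC'
  rw [coe_substAlgHom] at hC'
  have hM := motzkinSeries_eq_subst
  rw [← hb] at hM
  have hG := mk_one_mul_one_sub_eq_one ℚ
  set G : PowerSeries ℚ := PowerSeries.mk 1
  set T := (catalanSeries.map (Nat.castRingHom ℚ)).subst b
  have h1 : (1 - PowerSeries.X) * motzkinSeries = T := by
    rw [hM, ← mul_assoc, mul_comm (1 - _), hG, one_mul]
  have h2 : T = 1 + PowerSeries.X ^ 2 * motzkinSeries ^ 2 := by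
    rw [← hC', hM, hb]
    ring
  linear_combination h1 + h2

/-- Shifted Chebyshev polynomials of the second kind, orthogonal for the Motzkin moments. -/
noncomputable def motzkinOrtho : ℕ → ℚ[X]
  | 0 => 1
  | 1 => X - 1
  | k + 2 => (X - 1) * motzkinOrtho (k + 1) - motzkinOrtho k

/-- The linear functional on polynomials whose moments are the Motzkin numbers. -/
noncomputable def motzkinFunctional : ℚ[X] →ₗ[ℚ] ℚ :=
  Polynomial.lsum fun k => (motzkin k : ℚ) • LinearMap.id

lemma motzkinFunctional_X_pow (k : ℕ) : motzkinFunctional (X ^ k) = motzkin k := by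
  rw [X_pow_eq_monomial, motzkinFunctional, Polynomial.lsum_apply, sum_monomial_index] <;> simp

lemma motzkinFunctional_X_pow_mul_ortho (j : ℕ) : ∀ k, motzkinFunctional (X ^ k * motzkinOrtho j) =
    PowerSeries.coeff k (PowerSeries.X ^ j * motzkinSeries ^ (j + 1)) := by
  have hM := motzkinSeries_functional_equation
  induction j using Nat.strong_induction_on with
  | _ j ih =>
    match j, ih with
    | 0, _ =>
      intro k
      simp [motzkinOrtho, motzkinFunctional_X_pow, motzkinSeries]
    | 1, _ =>
      intro k
      have h : PowerSeries.X * (PowerSeries.X ^ 1 * motzkinSeries ^ (1 + 1)) =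
          motzkinSeries - 1 - PowerSeries.X * motzkinSeries := by
        linear_combination -hM
      have h' := congrArg (PowerSeries.coeff (k + 1)) h
      rw [PowerSeries.coeff_succ_X_mul] at h'
      rw [h', motzkinOrtho, mul_sub, mul_one, ← pow_succ, map_sub, motzkinFunctional_X_pow,
        motzkinFunctional_X_pow]
      simp [motzkinSeries, PowerSeries.coeff_succ_X_mul, PowerSeries.coeff_one]
    | j + 2, ih =>
      intro k
      -- The functional equation times `x^(j+1) M^(j+1)`. Its coefficient at `k + 1` mirrors the
      -- three-term recurrence multiplied by `X^k`.
      have h : PowerSeries.X * (PowerSeries.X ^ (j + 2) * motzkinSeries ^ (j + 2 + 1)) =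
          PowerSeries.X ^ (j + 1) * motzkinSeries ^ (j + 1 + 1) -
          PowerSeries.X * (PowerSeries.X ^ j * motzkinSeries ^ (j + 1)) -
          PowerSeries.X * (PowerSeries.X ^ (j + 1) * motzkinSeries ^ (j + 1 + 1)) := by
        linear_combination -(PowerSeries.X ^ (j + 1) * motzkinSeries ^ (j + 1)) * hM
      have h' := congrArg (PowerSeries.coeff (k + 1)) h
      rw [PowerSeries.coeff_succ_X_mul, map_sub, map_sub, PowerSeries.coeff_succ_X_mul,
        PowerSeries.coeff_succ_X_mul, ← ih (j + 1) (by omega), ← ih (j + 1) (by omega),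
        ← ih j (by omega)] at h'
      rw [h', motzkinOrtho, ← map_sub, ← map_sub]
      congr 1
      ring

lemma motzkinOrtho_monic_natDegree (k : ℕ) :
    (motzkinOrtho k).Monic ∧ (motzkinOrtho k).natDegree = k := by
  induction k using Nat.strong_induction_on with
  | _ k ih =>
    match k, ih with
    | 0, _ => simp [motzkinOrtho]
    | 1, _ =>
      rw [motzkinOrtho, ← C_1]
      exact ⟨monic_X_sub_C 1, natDegree_X_sub_C 1⟩
    | k + 2, ih =>
      obtain ⟨m1, d1⟩ := ih (k + 1) (by omega)
      obtain ⟨m0, d0⟩ := ih k (by omega)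
      have hm : ((X - 1 : ℚ[X]) * motzkinOrtho (k + 1)).Monic := by
        rw [← C_1]
        exact (monic_X_sub_C 1).mul m1
      have hd : ((X - 1 : ℚ[X]) * motzkinOrtho (k + 1)).natDegree = k + 2 := by
        rw [← C_1, (monic_X_sub_C 1).natDegree_mul m1, natDegree_X_sub_C, d1]
        omega
      have hlt : (motzkinOrtho k).degree < ((X - 1 : ℚ[X]) * motzkinOrtho (k + 1)).degree := by
        apply degree_lt_degree
        omega
      rw [motzkinOrtho]
      refine ⟨hm.sub_of_left hlt, ?_⟩
      rw [natDegree_sub_eq_left_of_natDegree_lt (by omega), hd]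

lemma motzkinOrtho_monic (k : ℕ) : (motzkinOrtho k).Monic := (motzkinOrtho_monic_natDegree k).1

lemma motzkinOrtho_natDegree (k : ℕ) : (motzkinOrtho k).natDegree = k :=
  (motzkinOrtho_monic_natDegree k).2

lemma motzkinFunctional_X_pow_mul_ortho_of_lt {k j : ℕ} (h : k < j) :
    motzkinFunctional (X ^ k * motzkinOrtho j) = 0 := by
  rw [motzkinFunctional_X_pow_mul_ortho, PowerSeries.coeff_X_pow_mul', if_neg (by omega)]

lemma motzkinFunctional_X_pow_mul_ortho_self (j : ℕ) :
    motzkinFunctional (X ^ j * motzkinOrtho j) = 1 := by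
  rw [motzkinFunctional_X_pow_mul_ortho, PowerSeries.coeff_X_pow_mul', if_pos le_rfl,
    Nat.sub_self, PowerSeries.coeff_zero_eq_constantCoeff_apply, map_pow]
  simp [motzkinSeries, motzkin]

/-- By orthogonality to lower degrees, only the term of `p` in degree `j` survives. -/
lemma motzkinFunctional_mul_ortho {p : ℚ[X]} {j : ℕ} (h : p.natDegree ≤ j) :
    motzkinFunctional (p * motzkinOrtho j) = p.coeff j := by
  conv_lhs => rw [p.as_sum_range_C_mul_X_pow' (Nat.lt_succ_of_le h)]
  rw [Finset.sum_mul, map_sum, Finset.sum_range_succ, Finset.sum_eq_zero, zero_add, mul_assoc,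
    ← smul_eq_C_mul, map_smul, motzkinFunctional_X_pow_mul_ortho_self, smul_eq_mul, mul_one]
  intro i hi
  rw [mul_assoc, ← smul_eq_C_mul, map_smul,
    motzkinFunctional_X_pow_mul_ortho_of_lt (Finset.mem_range.mp hi), smul_zero]

lemma motzkinFunctional_mul_ortho_of_lt {p : ℚ[X]} {j : ℕ} (h : p.natDegree < j) :
    motzkinFunctional (p * motzkinOrtho j) = 0 := by
  rw [motzkinFunctional_mul_ortho h.le, coeff_eq_zero_of_natDegree_lt h]

lemma motzkinFunctional_mul_ortho_of_monic {p : ℚ[X]} {j : ℕ} (hp : p.Monic)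
    (h : p.natDegree = j) : motzkinFunctional (p * motzkinOrtho j) = 1 := by
  rw [motzkinFunctional_mul_ortho h.le, ← h, hp.coeff_natDegree]

/-- The case `j = 6` produces `x^6 M^7`; the extra factor `X ^ 6` undoes the shift. -/
lemma coeff_motzkinSeries_pow_seven (k : ℕ) :
    PowerSeries.coeff k (motzkinSeries ^ 7) =
      motzkinFunctional (X ^ k * (X ^ 6 * motzkinOrtho 6)) := by
  rw [← mul_assoc, ← pow_add, motzkinFunctional_X_pow_mul_ortho, PowerSeries.coeff_X_pow_mul',
    if_pos (by omega), Nat.add_sub_cancel]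

end Motzkin

/-! ### Congruences modulo the sixth orthogonal polynomial. -/

section Reduction

open Polynomial

lemma motzkinOrtho_add_two (n : ℕ) :
    motzkinOrtho (n + 2) = (X - 1) * motzkinOrtho (n + 1) - motzkinOrtho n := by
  rw [motzkinOrtho]

/-- The addition formula of Chebyshev polynomials of the second kind; both sides satisfy the same
recurrence in `n`. -/
lemma motzkinOrtho_add_seven (n : ℕ) : motzkinOrtho (n + 7) =
    motzkinOrtho 6 * motzkinOrtho (n + 1) - motzkinOrtho 5 * motzkinOrtho n := by
  induction n using Nat.twoStepInduction with
  | zero =>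
    simp only [motzkinOrtho]
    ring
  | one =>
    simp only [motzkinOrtho]
    ring
  | more n h0 h1 =>
    have e9 := motzkinOrtho_add_two (n + 7)
    have e3 := motzkinOrtho_add_two (n + 1)
    have e2 := motzkinOrtho_add_two n
    rw [show n + 7 + 1 = n + 8 from rfl, show n + 7 + 2 = n + 9 from rfl] at e9
    rw [show n + 1 + 1 = n + 2 from rfl, show n + 1 + 2 = n + 3 from rfl] at e3
    rw [show n + 1 + 7 = n + 8 from rfl, show n + 1 + 1 = n + 2 from rfl] at h1
    rw [show n + 2 + 7 = n + 9 from rfl, show n + 2 + 1 = n + 3 from rfl]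
    linear_combination e9 + (X - 1) * h1 - h0 - motzkinOrtho 6 * e3 + motzkinOrtho 5 * e2

lemma motzkinOrtho_six_dvd_add_fourteen (n : ℕ) :
    motzkinOrtho 6 ∣ motzkinOrtho (n + 14) - motzkinOrtho n := by
  -- A Cassini identity: `p_5` squares to 1 modulo `p_6`, while a shift of the index by 7 multiplies
  -- by `-p_5`.
  have h : motzkinOrtho 5 ^ 2 - 1 = motzkinOrtho 6 * motzkinOrtho 4 := by
    simp only [motzkinOrtho]
    ring
  refine ⟨motzkinOrtho (n + 8) - motzkinOrtho 5 * motzkinOrtho (n + 1) +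
    motzkinOrtho 4 * motzkinOrtho n, ?_⟩
  have h7 := motzkinOrtho_add_seven n
  have h14 := motzkinOrtho_add_seven (n + 7)
  rw [show n + 7 + 7 = n + 14 from rfl, show n + 7 + 1 = n + 8 from rfl] at h14
  linear_combination h14 - motzkinOrtho 5 * h7 + motzkinOrtho n * h

lemma motzkinOrtho_six_dvd_add_seven {j : ℕ} (hj : j < 6) :
    motzkinOrtho 6 ∣ motzkinOrtho (7 + j) - (-1 : ℚ) • motzkinOrtho (5 - j) := by
  rw [add_comm 7 j, motzkinOrtho_add_seven]
  have h : motzkinOrtho 6 ∣ motzkinOrtho 5 * motzkinOrtho j - motzkinOrtho (5 - j) := by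
    rcases j with _ | j
    · simp [motzkinOrtho]
    · refine ⟨motzkinOrtho j, ?_⟩
      have hj' : j < 5 := by omega
      clear hj
      interval_cases j <;> simp only [motzkinOrtho, Nat.reduceAdd, Nat.reduceSub] <;> ring
  have h' := (Dvd.intro (motzkinOrtho (j + 1)) rfl : motzkinOrtho 6 ∣ _).sub h
  convert h' using 1
  simp only [neg_smul, one_smul]
  ring

/-- The `i`-th coordinate, in the orthonormal basis `motzkinOrtho`, of the residue modulo
`motzkinOrtho 6`. -/
noncomputable def residueCoord (i : ℕ) : ℚ[X] →ₗ[ℚ] ℚ :=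
  motzkinFunctional ∘ₗ LinearMap.mulLeft ℚ (motzkinOrtho i) ∘ₗ modByMonicHom (motzkinOrtho 6)

lemma residueCoord_of_dvd (i : ℕ) {p : ℚ[X]} (h : motzkinOrtho 6 ∣ p) : residueCoord i p = 0 := by
  have : p %ₘ motzkinOrtho 6 = 0 := (modByMonic_eq_zero_iff_dvd (motzkinOrtho_monic 6)).2 h
  simp [residueCoord, modByMonicHom, this]

lemma motzkinFunctional_ortho_mul_ortho (i j : ℕ) :
    motzkinFunctional (motzkinOrtho i * motzkinOrtho j) = if i = j then 1 else 0 := by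
  rcases lt_trichotomy i j with h | rfl | h
  · rw [if_neg h.ne, motzkinFunctional_mul_ortho_of_lt]
    rwa [motzkinOrtho_natDegree]
  · rw [if_pos rfl, motzkinFunctional_mul_ortho_of_monic (motzkinOrtho_monic i)
      (motzkinOrtho_natDegree i)]
  · rw [if_neg h.ne', mul_comm, motzkinFunctional_mul_ortho_of_lt]
    rwa [motzkinOrtho_natDegree]

lemma residueCoord_ortho (i : ℕ) {j : ℕ} (hj : j < 6) :
    residueCoord i (motzkinOrtho j) = if i = j then 1 else 0 := by
  have : motzkinOrtho j %ₘ motzkinOrtho 6 = motzkinOrtho j := by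
    rw [modByMonic_eq_self_iff (motzkinOrtho_monic 6)]
    apply degree_lt_degree
    rwa [motzkinOrtho_natDegree, motzkinOrtho_natDegree]
  rw [← motzkinFunctional_ortho_mul_ortho]
  simp [residueCoord, modByMonicHom, this]

lemma residueCoord_congr (i : ℕ) {p q : ℚ[X]} (h : motzkinOrtho 6 ∣ p - q) :
    residueCoord i p = residueCoord i q := by
  rw [← sub_eq_zero, ← map_sub, residueCoord_of_dvd i h]

lemma natDet_residueCoord_add_fourteen (n : ℕ) :
    natDet 6 (fun i j => residueCoord i (motzkinOrtho (n + 14 + j))) =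
      natDet 6 (fun i j => residueCoord i (motzkinOrtho (n + j))) := by
  refine natDet_congr fun i _ j _ => residueCoord_congr i ?_
  rw [add_right_comm]
  exact motzkinOrtho_six_dvd_add_fourteen _

lemma natDet_residueCoord (m : ℕ) :
    natDet 6 (fun i j => residueCoord i (motzkinOrtho (7 * m + 7 + j))) = (-1) ^ (m + 1) := by
  induction m using Nat.twoStepInduction with
  | zero =>
    have : natDet 6 (fun i j => residueCoord i (motzkinOrtho (7 * 0 + 7 + j))) =
        natDet 6 (fun i j => if i = 5 - j then (-1 : ℚ) else 0) := by
      refine natDet_congr fun i _ j hj => ?_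
      rw [residueCoord_congr i (motzkinOrtho_six_dvd_add_seven hj), map_smul,
        residueCoord_ortho i (by omega)]
      simp
    rw [this]
    -- Six signs cancel, and reversing six columns takes 15 transpositions, so the determinant is
    -- -1.
    have hM : (Matrix.of fun i j : Fin 6 => if (i : ℕ) = 5 - j then (-1 : ℚ) else 0) =
        !![0, 0, 0, 0, 0, -1; 0, 0, 0, 0, -1, 0; 0, 0, 0, -1, 0, 0; 0, 0, -1, 0, 0, 0;
          0, -1, 0, 0, 0, 0; -1, 0, 0, 0, 0, 0] := by
      ext i j
      fin_cases i <;> fin_cases j <;> rfl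
    unfold natDet
    rw [hM]
    simp [Matrix.det_succ_row_zero, Fin.sum_univ_succ, Fin.succAbove]
    norm_num
  | one =>
    rw [show 7 * 1 + 7 = 0 + 14 from rfl, natDet_residueCoord_add_fourteen,
      natDet_lower_unitriangular]
    · norm_num
    · intro i _ j hj hij
      rw [zero_add, residueCoord_ortho i hj, if_neg (by omega)]
    · intro i hi
      rw [zero_add, residueCoord_ortho i hi, if_pos rfl]
  | more m h0 _ =>
    rw [show 7 * (m + 2) + 7 = 7 * m + 7 + 14 by ring, natDet_residueCoord_add_fourteen, h0]
    ring

/-- Multiples of `motzkinOrtho 6` of the form `X ^ k * motzkinOrtho r`: exponents descend over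
`r = 7 m + 6` for the first `a` indices, then ascend over `r = 7 m + 13`. -/
noncomputable def kernelColumn (m a j : ℕ) : ℚ[X] :=
  if j < a then X ^ (a - 1 - j) * motzkinOrtho (7 * m + 6)
  else X ^ (j - a) * motzkinOrtho (7 * m + 13)

lemma motzkinOrtho_six_dvd (m : ℕ) : motzkinOrtho 6 ∣ motzkinOrtho (7 * m + 6) := by
  induction m with
  | zero => exact dvd_rfl
  | succ m ih =>
    rw [show 7 * (m + 1) + 6 = 7 * m + 6 + 7 by ring, motzkinOrtho_add_seven]
    exact (Dvd.intro _ rfl).sub (ih.mul_left _)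

lemma motzkinOrtho_six_dvd_kernelColumn (m a j : ℕ) : motzkinOrtho 6 ∣ kernelColumn m a j := by
  unfold kernelColumn
  split_ifs
  · exact (motzkinOrtho_six_dvd m).mul_left _
  · exact (motzkinOrtho_six_dvd (m + 1)).mul_left _

lemma monic_X_pow_mul_ortho (k j : ℕ) : (X ^ k * motzkinOrtho j).Monic :=
  (monic_X_pow k).mul (motzkinOrtho_monic j)

lemma natDegree_X_pow_mul_ortho (k j : ℕ) : (X ^ k * motzkinOrtho j).natDegree = k + j := by
  rw [(monic_X_pow k).natDegree_mul (motzkinOrtho_monic j), natDegree_X_pow,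
    motzkinOrtho_natDegree]

lemma motzkinOrtho_six_coeff_zero : (motzkinOrtho 6).coeff 0 = 1 := by
  rw [coeff_zero_eq_eval_zero]
  norm_num [motzkinOrtho]

/-! ### First evaluation: residues and coefficients. -/

/-- The columns of the square matrix from which both sides of the reduction are read off. -/
noncomputable def fullColumn (m a j : ℕ) : ℚ[X] :=
  if j < 6 then motzkinOrtho (7 * m + 7 + j)
  else if j < 12 then kernelColumn m a (j - 6)
  else X ^ (j - 12) * (X ^ 6 * motzkinOrtho 6)

/-- Coordinates modulo `motzkinOrtho 6`, then low coefficients, then high coefficients. -/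
noncomputable def residueTest (i : ℕ) : ℚ[X] →ₗ[ℚ] ℚ :=
  if i < 6 then residueCoord i else if i < 12 then lcoeff ℚ (i - 6) else lcoeff ℚ i

/-- The monic basis on which `residueTest` is unitriangular by blocks. -/
noncomputable def residueBasis (j : ℕ) : ℚ[X] :=
  if j < 6 then motzkinOrtho j else X ^ (j - 6) * motzkinOrtho 6

lemma residueTest_add_six (i : ℕ) (p : ℚ[X]) :
    residueTest (6 + i) p = p.coeff (if i < 6 then i else 6 + i) := by
  unfold residueTest
  rw [if_neg (by omega)]
  by_cases h : i < 6
  · rw [if_pos (by omega), if_pos h, lcoeff_apply, Nat.add_sub_cancel_left]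
  · rw [if_neg (by omega), if_neg h, lcoeff_apply]

/-- Multiples of `p_6` have zero residue. Among them, the shifts below `X^6` are unitriangular in
the low coefficients because `p_6(0) = 1`, and the later ones have no low coefficients and are monic
of degree at least 12. -/
lemma natDet_residueTest_basis (N : ℕ) :
    natDet (6 + (6 + N)) (fun i j => residueTest i (residueBasis j)) = 1 := by
  rw [natDet_add_of_upper_right_zero, natDet_lower_unitriangular, one_mul,
    natDet_add_of_upper_right_zero, natDet_lower_unitriangular, one_mul,
    natDet_upper_unitriangular]
  · intro i _ j _ hij
    rw [residueTest_add_six, if_neg (by omega), residueBasis, if_neg (by omega)]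
    apply coeff_eq_zero_of_natDegree_lt
    rw [natDegree_X_pow_mul_ortho]
    omega
  · intro i _
    rw [residueTest_add_six, if_neg (by omega), residueBasis, if_neg (by omega)]
    have := (monic_X_pow_mul_ortho (6 + (6 + i) - 6) 6).coeff_natDegree
    rw [natDegree_X_pow_mul_ortho] at this
    rw [← this]
    congr 1
    omega
  · intro i hi j _ hij
    rw [residueTest_add_six, if_pos hi, residueBasis, if_neg (by omega), coeff_X_pow_mul',
      if_neg (by omega)]
  · intro i hi
    rw [residueTest_add_six, if_pos hi, residueBasis, if_neg (by omega), coeff_X_pow_mul',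
      if_pos (by omega), ← motzkinOrtho_six_coeff_zero]
    congr 1
    omega
  · intro i hi j _
    rw [residueTest_add_six, if_pos hi, residueBasis, if_neg (by omega), coeff_X_pow_mul',
      if_neg (by omega)]
  · intro i hi j hj hij
    rw [residueTest, if_pos hi, residueBasis, if_pos hj, residueCoord_ortho i hj,
      if_neg (by omega)]
  · intro i hi
    rw [residueTest, if_pos hi, residueBasis, if_pos hi, residueCoord_ortho i hi, if_pos rfl]
  · intro i hi j _
    rw [residueTest, if_pos hi, residueBasis, if_neg (by omega)]
    exact residueCoord_of_dvd i (Dvd.intro_left _ rfl)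

lemma residueBasis_monic (j : ℕ) : (residueBasis j).Monic := by
  unfold residueBasis
  split_ifs
  · exact motzkinOrtho_monic j
  · exact monic_X_pow_mul_ortho _ _

lemma residueBasis_natDegree (j : ℕ) : (residueBasis j).natDegree = j := by
  unfold residueBasis
  split_ifs
  · exact motzkinOrtho_natDegree j
  · rw [natDegree_X_pow_mul_ortho]
    omega

lemma natDet_residueTest_fullColumn (m a N : ℕ) :
    natDet (6 + (6 + N)) (fun i j => residueTest i (fullColumn m a j)) =
      (-1) ^ (m + 1) * natDet 6 (fun i j => (kernelColumn m a j).coeff i) := by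
  rw [natDet_add_of_upper_right_zero, natDet_add_of_upper_right_zero,
    natDet_upper_unitriangular (n := N), mul_one, ← natDet_residueCoord]
  · have h1 : natDet 6 (fun i j => residueTest i (fullColumn m a j)) =
        natDet 6 (fun i j => residueCoord i (motzkinOrtho (7 * m + 7 + j))) := by
      refine natDet_congr fun i hi j hj => ?_
      rw [residueTest, if_pos hi, fullColumn, if_pos hj]
    have h2 : natDet 6 (fun i j => residueTest (6 + i) (fullColumn m a (6 + j))) =
        natDet 6 (fun i j => (kernelColumn m a j).coeff i) := by
      refine natDet_congr fun i hi j hj => ?_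
      rw [residueTest_add_six, if_pos hi, fullColumn, if_neg (by omega), if_pos (by omega),
        Nat.add_sub_cancel_left]
    rw [h1, h2]
  · intro i _ j _ hij
    rw [residueTest_add_six, if_neg (by omega), fullColumn, if_neg (by omega), if_neg (by omega),
      ← mul_assoc, ← pow_add]
    apply coeff_eq_zero_of_natDegree_lt
    rw [natDegree_X_pow_mul_ortho]
    omega
  · intro i _
    rw [residueTest_add_six, if_neg (by omega), fullColumn, if_neg (by omega), if_neg (by omega),
      ← mul_assoc, ← pow_add]
    have := (monic_X_pow_mul_ortho (6 + (6 + i) - 12 + 6) 6).coeff_natDegree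
    rw [natDegree_X_pow_mul_ortho] at this
    rw [← this]
    congr 1
    omega
  · intro i hi j _
    rw [residueTest_add_six, if_pos hi, fullColumn, if_neg (by omega), if_neg (by omega),
      ← mul_assoc, ← pow_add, coeff_X_pow_mul', if_neg (by omega)]
  · intro i hi j hj
    rw [residueTest, if_pos hi, fullColumn, if_neg (by omega)]
    apply residueCoord_of_dvd
    split_ifs
    · exact motzkinOrtho_six_dvd_kernelColumn _ _ _
    · rw [← mul_assoc]
      exact Dvd.intro_left _ rfl

/-! ### Second evaluation: orthogonality. -/

/-- Pairing with the `i`-th orthogonal polynomial. -/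
noncomputable def orthoTest (i : ℕ) : ℚ[X] →ₗ[ℚ] ℚ :=
  motzkinFunctional ∘ₗ LinearMap.mulLeft ℚ (motzkinOrtho i)

lemma orthoTest_of_natDegree_lt {i : ℕ} {p : ℚ[X]} (h : p.natDegree < i) : orthoTest i p = 0 := by
  rw [orthoTest, LinearMap.comp_apply, LinearMap.mulLeft_apply, mul_comm,
    motzkinFunctional_mul_ortho_of_lt h]

lemma orthoTest_of_monic {i : ℕ} {p : ℚ[X]} (hp : p.Monic) (h : p.natDegree = i) :
    orthoTest i p = 1 := by
  rw [orthoTest, LinearMap.comp_apply, LinearMap.mulLeft_apply, mul_comm,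
    motzkinFunctional_mul_ortho_of_monic hp h]

lemma orthoTest_X_pow_mul_ortho_of_lt {i k j : ℕ} (h : k + i < j) :
    orthoTest i (X ^ k * motzkinOrtho j) = 0 := by
  rw [orthoTest, LinearMap.comp_apply, LinearMap.mulLeft_apply, mul_left_comm, ← mul_assoc,
    motzkinFunctional_mul_ortho_of_lt]
  rwa [natDegree_X_pow_mul_ortho]

lemma orthoTest_X_pow_mul_ortho_of_eq {i k j : ℕ} (h : k + i = j) :
    orthoTest i (X ^ k * motzkinOrtho j) = 1 := by
  rw [orthoTest, LinearMap.comp_apply, LinearMap.mulLeft_apply, mul_left_comm, ← mul_assoc,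
    motzkinFunctional_mul_ortho_of_monic (monic_X_pow_mul_ortho _ _)]
  rwa [natDegree_X_pow_mul_ortho]

lemma orthoTest_ortho (i j : ℕ) : orthoTest i (motzkinOrtho j) = if i = j then 1 else 0 :=
  motzkinFunctional_ortho_mul_ortho i j

/-- Regard `L(X^j w ·)` as the functionals; replacing the monic `p_i` by `X^i` then leaves the
determinant unchanged. -/
lemma natDet_orthoTest_weight (N : ℕ) :
    natDet N (fun i j => orthoTest i (X ^ j * (X ^ 6 * motzkinOrtho 6))) =
      hankelDet (motzkinSeries ^ 7) N := by
  let χ : ℕ → ℚ[X] →ₗ[ℚ] ℚ := fun j =>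
    motzkinFunctional ∘ₗ LinearMap.mulLeft ℚ (X ^ j * (X ^ 6 * motzkinOrtho 6))
  calc natDet N (fun i j => orthoTest i (X ^ j * (X ^ 6 * motzkinOrtho 6)))
      = natDet N (fun j i => χ j (motzkinOrtho i)) := by
        rw [← natDet_transpose]
        refine natDet_congr fun i _ j _ => ?_
        simp only [orthoTest, χ, LinearMap.comp_apply, LinearMap.mulLeft_apply]
        rw [mul_comm]
    _ = natDet N (fun j i => χ j (X ^ i)) :=
        natDet_linear_apply_monic χ _ motzkinOrtho_monic motzkinOrtho_natDegree
    _ = natDet N (fun i j => PowerSeries.coeff (i + j) (motzkinSeries ^ 7)) := by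
        refine natDet_congr fun i _ j _ => ?_
        simp only [χ, LinearMap.comp_apply, LinearMap.mulLeft_apply]
        rw [coeff_motzkinSeries_pow_seven, pow_add]
        congr 1
        ring
    _ = hankelDet (motzkinSeries ^ 7) N := rfl

lemma natDet_orthoTest_middle {m a N : ℕ} (ha : a ≤ 6) (hN : N + a = 7 * m + 7) :
    natDet 12 (fun i j => orthoTest (N + i) (fullColumn m a j)) = 1 := by
  obtain ⟨b, hb⟩ : ∃ b, a + 6 + b = 12 := ⟨6 - a, by omega⟩
  have hleft : ∀ j < a, fullColumn m a (j + 6) = X ^ (a - 1 - j) * motzkinOrtho (7 * m + 6) := by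
    intro j hj
    rw [fullColumn, if_neg (by omega), if_pos (by omega), Nat.add_sub_cancel, kernelColumn,
      if_pos hj]
  have hmid : ∀ j < 6, fullColumn m a j = motzkinOrtho (7 * m + 7 + j) := by
    intro j hj
    rw [fullColumn, if_pos hj]
  have hright : ∀ j < b, fullColumn m a (a + 6 + j) = X ^ j * motzkinOrtho (7 * m + 13) := by
    intro j hj
    rw [fullColumn, if_neg (by omega), if_pos (by omega), kernelColumn, if_neg (by omega)]
    congr 2
    omega
  -- Moving the `a` shifts of `p_{7m+6}` before the six `p_{7m+7+j}` makes their first nonzero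
  -- pairings occur at consecutive indices from `N` on, with value 1. The remaining `6 - a` columns
  -- have consecutive degrees from `7m + 13` on, above those of all other columns here.
  rw [← hb, natDet_add_of_lower_left_zero, ← natDet_rotate (p := a) (q := 6) (by decide),
    natDet_lower_unitriangular, one_mul, natDet_upper_unitriangular]
  · intro i hi j hj hij
    rw [hright j hj, orthoTest_of_natDegree_lt]
    rw [natDegree_X_pow_mul_ortho]
    omega
  · intro i hi
    rw [hright i hi, orthoTest_of_monic (monic_X_pow_mul_ortho _ _)]
    rw [natDegree_X_pow_mul_ortho]
    omega
  · intro i hi j hj hij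
    split_ifs with h
    · rw [hleft j h, orthoTest_X_pow_mul_ortho_of_lt (by omega)]
    · rw [hmid _ (by omega), orthoTest_ortho, if_neg (by omega)]
  · intro i hi
    split_ifs with h
    · rw [hleft i h, orthoTest_X_pow_mul_ortho_of_eq (by omega)]
    · rw [hmid _ (by omega), orthoTest_ortho, if_pos (by omega)]
  · intro i hi j hj
    by_cases h : j < 6
    · rw [hmid j h, orthoTest_ortho, if_neg (by omega)]
    · obtain ⟨k, rfl⟩ : ∃ k, j = k + 6 := ⟨j - 6, by omega⟩
      rw [hleft k (by omega), orthoTest_of_natDegree_lt]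
      rw [natDegree_X_pow_mul_ortho]
      omega

lemma natDet_orthoTest_fullColumn {m a N : ℕ} (ha : a ≤ 6) (hN : N + a = 7 * m + 7) :
    natDet (N + 12) (fun i j => orthoTest i (fullColumn m a j)) =
      hankelDet (motzkinSeries ^ 7) N := by
  rw [← natDet_rotate (by decide), natDet_add_of_upper_right_zero, ← natDet_orthoTest_weight]
  · have h1 : natDet N (fun i j => orthoTest i
        (fullColumn m a (if j < N then j + 12 else j - N))) =
        natDet N (fun i j => orthoTest i (X ^ j * (X ^ 6 * motzkinOrtho 6))) := by
      refine natDet_congr fun i _ j hj => ?_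
      rw [if_pos hj, fullColumn, if_neg (by omega), if_neg (by omega), Nat.add_sub_cancel]
    have h2 : natDet 12 (fun i j => orthoTest (N + i)
        (fullColumn m a (if N + j < N then N + j + 12 else N + j - N))) = 1 := by
      rw [← natDet_orthoTest_middle ha hN]
      refine natDet_congr fun i _ j _ => ?_
      rw [if_neg (by omega), Nat.add_sub_cancel_left]
    rw [h1, h2, mul_one]
  · intro i hi j hj
    rw [if_neg (by omega), Nat.add_sub_cancel_left, fullColumn]
    split_ifs
    · rw [orthoTest_ortho, if_neg (by omega)]
    · unfold kernelColumn
      split_ifs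
      · rw [orthoTest_X_pow_mul_ortho_of_lt (by omega)]
      · rw [orthoTest_X_pow_mul_ortho_of_lt (by omega)]

lemma fullColumn_natDegree_lt {m a N j : ℕ} (ha : a ≤ 6) (hN : N + a = 7 * m + 7)
    (hj : j < N + 12) : (fullColumn m a j).natDegree < N + 12 := by
  unfold fullColumn kernelColumn
  split_ifs
  · rw [motzkinOrtho_natDegree]
    omega
  · rw [natDegree_X_pow_mul_ortho]
    omega
  · rw [natDegree_X_pow_mul_ortho]
    omega
  · rw [← mul_assoc, ← pow_add, natDegree_X_pow_mul_ortho]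
    omega

/-- The Hankel determinants of `M ^ 7` reduce to determinants of size six. -/
theorem hankelDet_motzkinSeries_pow_seven {m a N : ℕ} (ha : a ≤ 6) (hN : N + a = 7 * m + 7) :
    hankelDet (motzkinSeries ^ 7) N =
      (-1) ^ (m + 1) * natDet 6 (fun i j => (kernelColumn m a j).coeff i) := by
  have hX : natDet (N + 12) (fun i k => orthoTest i (X ^ k)) = 1 := by
    apply natDet_upper_unitriangular
    · intro i _ j _ hij
      rw [orthoTest_of_natDegree_lt (by rwa [natDegree_X_pow])]
    · intro i _
      rw [orthoTest_of_monic (monic_X_pow i) (natDegree_X_pow i)]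
  rw [← natDet_orthoTest_fullColumn ha hN,
    natDet_linear_apply _ _ fun j hj => fullColumn_natDegree_lt ha hN hj, hX, one_mul,
    ← natDet_residueTest_fullColumn m a N]
  -- Evaluated on monomials, the family `residueTest` also has determinant 1, since `residueBasis`
  -- is monic with one element in each degree.
  have h := natDet_residueTest_basis N
  rw [show 6 + (6 + N) = N + 12 by ring] at h ⊢
  rw [natDet_linear_apply residueTest _ fun j hj => fullColumn_natDegree_lt ha hN hj,
    ← natDet_linear_apply_monic residueTest residueBasis residueBasis_monic residueBasis_natDegree,
    h, one_mul]

end Reduction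

/-! ### Explicit expansion of the 6 × 6 determinants. -/

section Evaluation

open Polynomial

/-- The determinant of shifted copies of two sequences to which the Hankel determinants reduce. -/
def shiftDet (a : ℕ) (f g : ℕ → ℚ) : ℚ :=
  natDet 6 fun i j =>
    if j < a then (if a - 1 - j ≤ i then f (i - (a - 1 - j)) else 0)
    else (if j - a ≤ i then g (i - (j - a)) else 0)

lemma natDet_kernelColumn (m a : ℕ) :
    natDet 6 (fun i j => (kernelColumn m a j).coeff i) =
      shiftDet a (motzkinOrtho (7 * m + 6)).coeff (motzkinOrtho (7 * m + 13)).coeff := by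
  refine natDet_congr fun i _ j _ => ?_
  unfold kernelColumn
  split_ifs with h1 h2 h2 <;> simp [coeff_X_pow_mul', h2]

lemma shiftDet_zero (f g : ℕ → ℚ) : shiftDet 0 f g =
    g 0 ^ 6 := by
  have hM : shiftDet 0 f g = Matrix.det
      !![g 0, 0, 0, 0, 0, 0;
        g 1, g 0, 0, 0, 0, 0;
        g 2, g 1, g 0, 0, 0, 0;
        g 3, g 2, g 1, g 0, 0, 0;
        g 4, g 3, g 2, g 1, g 0, 0;
        g 5, g 4, g 3, g 2, g 1, g 0] := by
    unfold shiftDet natDet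
    congr 1
    ext i j
    fin_cases i <;> fin_cases j <;> rfl
  rw [hM]
  simp [Matrix.det_succ_row_zero, Fin.sum_univ_succ, Fin.succAbove]
  ring

lemma shiftDet_one (f g : ℕ → ℚ) : shiftDet 1 f g =
    f 0 * g 0 ^ 4 * g 5 - 2 * f 0 * g 0 ^ 3 * g 1 * g 4 - 2 * f 0 * g 0 ^ 3 * g 2 * g 3 +
      3 * f 0 * g 0 ^ 2 * g 1 ^ 2 * g 3 + 3 * f 0 * g 0 ^ 2 * g 1 * g 2 ^ 2 -
      4 * f 0 * g 0 * g 1 ^ 3 * g 2 + f 0 * g 1 ^ 5 + f 1 * g 0 ^ 4 * g 4 -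
      2 * f 1 * g 0 ^ 3 * g 1 * g 3 - f 1 * g 0 ^ 3 * g 2 ^ 2 +
      3 * f 1 * g 0 ^ 2 * g 1 ^ 2 * g 2 - f 1 * g 0 * g 1 ^ 4 + f 2 * g 0 ^ 4 * g 3 -
      2 * f 2 * g 0 ^ 3 * g 1 * g 2 + f 2 * g 0 ^ 2 * g 1 ^ 3 + f 3 * g 0 ^ 4 * g 2 -
      f 3 * g 0 ^ 3 * g 1 ^ 2 + f 4 * g 0 ^ 4 * g 1 - f 5 * g 0 ^ 5 := by
  have hM : shiftDet 1 f g = Matrix.det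
      !![f 0, g 0, 0, 0, 0, 0;
        f 1, g 1, g 0, 0, 0, 0;
        f 2, g 2, g 1, g 0, 0, 0;
        f 3, g 3, g 2, g 1, g 0, 0;
        f 4, g 4, g 3, g 2, g 1, g 0;
        f 5, g 5, g 4, g 3, g 2, g 1] := by
    unfold shiftDet natDet
    congr 1
    ext i j
    fin_cases i <;> fin_cases j <;> rfl
  rw [hM]
  simp [Matrix.det_succ_row_zero, Fin.sum_univ_succ, Fin.succAbove]
  ring

lemma shiftDet_two (f g : ℕ → ℚ) : shiftDet 2 f g =
    f 0 ^ 2 * g 0 ^ 2 * g 3 * g 5 - f 0 ^ 2 * g 0 ^ 2 * g 4 ^ 2 -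
      2 * f 0 ^ 2 * g 0 * g 1 * g 2 * g 5 + 2 * f 0 ^ 2 * g 0 * g 1 * g 3 * g 4 +
      2 * f 0 ^ 2 * g 0 * g 2 ^ 2 * g 4 - 2 * f 0 ^ 2 * g 0 * g 2 * g 3 ^ 2 +
      f 0 ^ 2 * g 1 ^ 3 * g 5 - 2 * f 0 ^ 2 * g 1 ^ 2 * g 2 * g 4 -
      f 0 ^ 2 * g 1 ^ 2 * g 3 ^ 2 + 3 * f 0 ^ 2 * g 1 * g 2 ^ 2 * g 3 - f 0 ^ 2 * g 2 ^ 4 +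
      f 0 * f 1 * g 0 ^ 2 * g 2 * g 5 - f 0 * f 1 * g 0 ^ 2 * g 3 * g 4 -
      f 0 * f 1 * g 0 * g 1 ^ 2 * g 5 + 2 * f 0 * f 1 * g 0 * g 1 * g 3 ^ 2 -
      f 0 * f 1 * g 0 * g 2 ^ 2 * g 3 + f 0 * f 1 * g 1 ^ 3 * g 4 -
      2 * f 0 * f 1 * g 1 ^ 2 * g 2 * g 3 + f 0 * f 1 * g 1 * g 2 ^ 3 +
      f 0 * f 2 * g 0 ^ 2 * g 1 * g 5 - 2 * f 0 * f 2 * g 0 ^ 2 * g 2 * g 4 +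
      f 0 * f 2 * g 0 ^ 2 * g 3 ^ 2 - 2 * f 0 * f 2 * g 0 * g 1 * g 2 * g 3 +
      2 * f 0 * f 2 * g 0 * g 2 ^ 3 + f 0 * f 2 * g 1 ^ 3 * g 3 -
      f 0 * f 2 * g 1 ^ 2 * g 2 ^ 2 - f 0 * f 3 * g 0 ^ 3 * g 5 +
      3 * f 0 * f 3 * g 0 ^ 2 * g 2 * g 3 - 3 * f 0 * f 3 * g 0 * g 1 * g 2 ^ 2 +
      f 0 * f 3 * g 1 ^ 3 * g 2 + 2 * f 0 * f 4 * g 0 ^ 3 * g 4 -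
      3 * f 0 * f 4 * g 0 ^ 2 * g 1 * g 3 - 2 * f 0 * f 4 * g 0 ^ 2 * g 2 ^ 2 +
      4 * f 0 * f 4 * g 0 * g 1 ^ 2 * g 2 - f 0 * f 4 * g 1 ^ 4 -
      f 0 * f 5 * g 0 ^ 3 * g 3 + 2 * f 0 * f 5 * g 0 ^ 2 * g 1 * g 2 -
      f 0 * f 5 * g 0 * g 1 ^ 3 + f 1 ^ 2 * g 0 ^ 2 * g 2 * g 4 -
      f 1 ^ 2 * g 0 ^ 2 * g 3 ^ 2 - f 1 ^ 2 * g 0 * g 1 ^ 2 * g 4 +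
      2 * f 1 ^ 2 * g 0 * g 1 * g 2 * g 3 - f 1 ^ 2 * g 0 * g 2 ^ 3 +
      f 1 * f 2 * g 0 ^ 2 * g 1 * g 4 - f 1 * f 2 * g 0 ^ 2 * g 2 * g 3 -
      f 1 * f 2 * g 0 * g 1 ^ 2 * g 3 + f 1 * f 2 * g 0 * g 1 * g 2 ^ 2 -
      f 1 * f 3 * g 0 ^ 3 * g 4 + 2 * f 1 * f 3 * g 0 ^ 2 * g 2 ^ 2 -
      f 1 * f 3 * g 0 * g 1 ^ 2 * g 2 + 2 * f 1 * f 4 * g 0 ^ 3 * g 3 -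
      3 * f 1 * f 4 * g 0 ^ 2 * g 1 * g 2 + f 1 * f 4 * g 0 * g 1 ^ 3 -
      f 1 * f 5 * g 0 ^ 3 * g 2 + f 1 * f 5 * g 0 ^ 2 * g 1 ^ 2 +
      f 2 ^ 2 * g 0 ^ 2 * g 1 * g 3 - f 2 ^ 2 * g 0 ^ 2 * g 2 ^ 2 -
      f 2 * f 3 * g 0 ^ 3 * g 3 + f 2 * f 3 * g 0 ^ 2 * g 1 * g 2 +
      2 * f 2 * f 4 * g 0 ^ 3 * g 2 - f 2 * f 4 * g 0 ^ 2 * g 1 ^ 2 -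
      f 2 * f 5 * g 0 ^ 3 * g 1 - f 3 ^ 2 * g 0 ^ 3 * g 2 + f 3 * f 4 * g 0 ^ 3 * g 1 +
      f 3 * f 5 * g 0 ^ 4 - f 4 ^ 2 * g 0 ^ 4 := by
  have hM : shiftDet 2 f g = Matrix.det
      !![0, f 0, g 0, 0, 0, 0;
        f 0, f 1, g 1, g 0, 0, 0;
        f 1, f 2, g 2, g 1, g 0, 0;
        f 2, f 3, g 3, g 2, g 1, g 0;
        f 3, f 4, g 4, g 3, g 2, g 1;
        f 4, f 5, g 5, g 4, g 3, g 2] := by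
    unfold shiftDet natDet
    congr 1
    ext i j
    fin_cases i <;> fin_cases j <;> rfl
  rw [hM]
  simp [Matrix.det_succ_row_zero, Fin.sum_univ_succ, Fin.succAbove]
  ring

set_option maxHeartbeats 1600000 in
lemma shiftDet_three (f g : ℕ → ℚ) : shiftDet 3 f g =
    f 0 ^ 3 * g 1 * g 3 * g 5 - f 0 ^ 3 * g 1 * g 4 ^ 2 - f 0 ^ 3 * g 2 ^ 2 * g 5 +
      2 * f 0 ^ 3 * g 2 * g 3 * g 4 - f 0 ^ 3 * g 3 ^ 3 - f 0 ^ 2 * f 1 * g 0 * g 3 * g 5 +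
      f 0 ^ 2 * f 1 * g 0 * g 4 ^ 2 + f 0 ^ 2 * f 1 * g 1 * g 2 * g 5 -
      f 0 ^ 2 * f 1 * g 1 * g 3 * g 4 - f 0 ^ 2 * f 1 * g 2 ^ 2 * g 4 +
      f 0 ^ 2 * f 1 * g 2 * g 3 ^ 2 + 2 * f 0 ^ 2 * f 2 * g 0 * g 2 * g 5 -
      2 * f 0 ^ 2 * f 2 * g 0 * g 3 * g 4 - f 0 ^ 2 * f 2 * g 1 ^ 2 * g 5 +
      2 * f 0 ^ 2 * f 2 * g 1 * g 3 ^ 2 - f 0 ^ 2 * f 2 * g 2 ^ 2 * g 3 -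
      f 0 ^ 2 * f 3 * g 0 * g 1 * g 5 - 2 * f 0 ^ 2 * f 3 * g 0 * g 2 * g 4 +
      3 * f 0 ^ 2 * f 3 * g 0 * g 3 ^ 2 + 2 * f 0 ^ 2 * f 3 * g 1 ^ 2 * g 4 -
      3 * f 0 ^ 2 * f 3 * g 1 * g 2 * g 3 + f 0 ^ 2 * f 3 * g 2 ^ 3 +
      2 * f 0 ^ 2 * f 4 * g 0 * g 1 * g 4 - 2 * f 0 ^ 2 * f 4 * g 0 * g 2 * g 3 -
      f 0 ^ 2 * f 4 * g 1 ^ 2 * g 3 + f 0 ^ 2 * f 4 * g 1 * g 2 ^ 2 -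
      f 0 ^ 2 * f 5 * g 0 * g 1 * g 3 + f 0 ^ 2 * f 5 * g 0 * g 2 ^ 2 -
      f 0 * f 1 ^ 2 * g 0 * g 2 * g 5 + f 0 * f 1 ^ 2 * g 0 * g 3 * g 4 +
      f 0 * f 1 ^ 2 * g 1 * g 2 * g 4 - f 0 * f 1 ^ 2 * g 1 * g 3 ^ 2 +
      f 0 * f 1 * f 2 * g 0 * g 1 * g 5 + 2 * f 0 * f 1 * f 2 * g 0 * g 2 * g 4 -
      3 * f 0 * f 1 * f 2 * g 0 * g 3 ^ 2 - f 0 * f 1 * f 2 * g 1 ^ 2 * g 4 +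
      f 0 * f 1 * f 2 * g 1 * g 2 * g 3 + f 0 * f 1 * f 3 * g 0 ^ 2 * g 5 -
      3 * f 0 * f 1 * f 3 * g 0 * g 1 * g 4 + f 0 * f 1 * f 3 * g 0 * g 2 * g 3 +
      2 * f 0 * f 1 * f 3 * g 1 ^ 2 * g 3 - f 0 * f 1 * f 3 * g 1 * g 2 ^ 2 -
      2 * f 0 * f 1 * f 4 * g 0 ^ 2 * g 4 + 3 * f 0 * f 1 * f 4 * g 0 * g 1 * g 3 -
      f 0 * f 1 * f 4 * g 1 ^ 2 * g 2 + f 0 * f 1 * f 5 * g 0 ^ 2 * g 3 -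
      f 0 * f 1 * f 5 * g 0 * g 1 * g 2 - f 0 * f 2 ^ 2 * g 0 ^ 2 * g 5 +
      2 * f 0 * f 2 ^ 2 * g 0 * g 2 * g 3 - f 0 * f 2 ^ 2 * g 1 ^ 2 * g 3 +
      2 * f 0 * f 2 * f 3 * g 0 ^ 2 * g 4 - f 0 * f 2 * f 3 * g 0 * g 1 * g 3 -
      2 * f 0 * f 2 * f 3 * g 0 * g 2 ^ 2 + f 0 * f 2 * f 3 * g 1 ^ 2 * g 2 +
      2 * f 0 * f 2 * f 4 * g 0 ^ 2 * g 3 - 2 * f 0 * f 2 * f 4 * g 0 * g 1 * g 2 +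
      f 0 * f 2 * f 4 * g 1 ^ 3 - 2 * f 0 * f 2 * f 5 * g 0 ^ 2 * g 2 +
      f 0 * f 2 * f 5 * g 0 * g 1 ^ 2 - 3 * f 0 * f 3 ^ 2 * g 0 ^ 2 * g 3 +
      3 * f 0 * f 3 ^ 2 * g 0 * g 1 * g 2 - f 0 * f 3 ^ 2 * g 1 ^ 3 +
      2 * f 0 * f 3 * f 4 * g 0 ^ 2 * g 2 - f 0 * f 3 * f 4 * g 0 * g 1 ^ 2 +
      f 0 * f 3 * f 5 * g 0 ^ 2 * g 1 - f 0 * f 4 ^ 2 * g 0 ^ 2 * g 1 -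
      f 1 ^ 3 * g 0 * g 2 * g 4 + f 1 ^ 3 * g 0 * g 3 ^ 2 +
      f 1 ^ 2 * f 2 * g 0 * g 1 * g 4 - f 1 ^ 2 * f 2 * g 0 * g 2 * g 3 +
      f 1 ^ 2 * f 3 * g 0 ^ 2 * g 4 - 2 * f 1 ^ 2 * f 3 * g 0 * g 1 * g 3 +
      f 1 ^ 2 * f 3 * g 0 * g 2 ^ 2 - 2 * f 1 ^ 2 * f 4 * g 0 ^ 2 * g 3 +
      f 1 ^ 2 * f 4 * g 0 * g 1 * g 2 + f 1 ^ 2 * f 5 * g 0 ^ 2 * g 2 -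
      f 1 * f 2 ^ 2 * g 0 ^ 2 * g 4 + f 1 * f 2 ^ 2 * g 0 * g 1 * g 3 +
      3 * f 1 * f 2 * f 3 * g 0 ^ 2 * g 3 - f 1 * f 2 * f 3 * g 0 * g 1 * g 2 -
      f 1 * f 2 * f 4 * g 0 * g 1 ^ 2 - f 1 * f 2 * f 5 * g 0 ^ 2 * g 1 -
      2 * f 1 * f 3 ^ 2 * g 0 ^ 2 * g 2 + f 1 * f 3 ^ 2 * g 0 * g 1 ^ 2 +
      f 1 * f 3 * f 4 * g 0 ^ 2 * g 1 - f 1 * f 3 * f 5 * g 0 ^ 3 +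
      f 1 * f 4 ^ 2 * g 0 ^ 3 - f 2 ^ 3 * g 0 ^ 2 * g 3 + f 2 ^ 2 * f 3 * g 0 ^ 2 * g 2 +
      f 2 ^ 2 * f 4 * g 0 ^ 2 * g 1 + f 2 ^ 2 * f 5 * g 0 ^ 3 -
      f 2 * f 3 ^ 2 * g 0 ^ 2 * g 1 - 2 * f 2 * f 3 * f 4 * g 0 ^ 3 + f 3 ^ 3 * g 0 ^ 3 := by
  have hM : shiftDet 3 f g = Matrix.det
      !![0, 0, f 0, g 0, 0, 0;
        0, f 0, f 1, g 1, g 0, 0;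
        f 0, f 1, f 2, g 2, g 1, g 0;
        f 1, f 2, f 3, g 3, g 2, g 1;
        f 2, f 3, f 4, g 4, g 3, g 2;
        f 3, f 4, f 5, g 5, g 4, g 3] := by
    unfold shiftDet natDet
    congr 1
    ext i j
    fin_cases i <;> fin_cases j <;> rfl
  rw [hM]
  simp [Matrix.det_succ_row_zero, Fin.sum_univ_succ, Fin.succAbove]
  ring

lemma shiftDet_four (f g : ℕ → ℚ) : shiftDet 4 f g =
    -f 0 ^ 4 * g 3 * g 5 + f 0 ^ 4 * g 4 ^ 2 + f 0 ^ 3 * f 1 * g 2 * g 5 -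
      f 0 ^ 3 * f 1 * g 3 * g 4 + f 0 ^ 3 * f 2 * g 1 * g 5 -
      2 * f 0 ^ 3 * f 2 * g 2 * g 4 + f 0 ^ 3 * f 2 * g 3 ^ 2 + f 0 ^ 3 * f 3 * g 0 * g 5 -
      2 * f 0 ^ 3 * f 3 * g 1 * g 4 + f 0 ^ 3 * f 3 * g 2 * g 3 -
      2 * f 0 ^ 3 * f 4 * g 0 * g 4 + f 0 ^ 3 * f 4 * g 1 * g 3 +
      f 0 ^ 3 * f 5 * g 0 * g 3 - f 0 ^ 2 * f 1 ^ 2 * g 1 * g 5 +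
      f 0 ^ 2 * f 1 ^ 2 * g 2 * g 4 - 2 * f 0 ^ 2 * f 1 * f 2 * g 0 * g 5 +
      3 * f 0 ^ 2 * f 1 * f 2 * g 1 * g 4 - f 0 ^ 2 * f 1 * f 2 * g 2 * g 3 +
      3 * f 0 ^ 2 * f 1 * f 3 * g 0 * g 4 - f 0 ^ 2 * f 1 * f 3 * g 2 ^ 2 -
      f 0 ^ 2 * f 1 * f 4 * g 1 * g 2 - f 0 ^ 2 * f 1 * f 5 * g 0 * g 2 +
      2 * f 0 ^ 2 * f 2 ^ 2 * g 0 * g 4 - 2 * f 0 ^ 2 * f 2 ^ 2 * g 1 * g 3 +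
      f 0 ^ 2 * f 2 ^ 2 * g 2 ^ 2 - 3 * f 0 ^ 2 * f 2 * f 3 * g 0 * g 3 +
      f 0 ^ 2 * f 2 * f 3 * g 1 * g 2 + 2 * f 0 ^ 2 * f 2 * f 4 * g 0 * g 2 -
      f 0 ^ 2 * f 2 * f 4 * g 1 ^ 2 - f 0 ^ 2 * f 2 * f 5 * g 0 * g 1 -
      f 0 ^ 2 * f 3 ^ 2 * g 0 * g 2 + f 0 ^ 2 * f 3 ^ 2 * g 1 ^ 2 +
      f 0 ^ 2 * f 3 * f 4 * g 0 * g 1 - f 0 ^ 2 * f 3 * f 5 * g 0 ^ 2 +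
      f 0 ^ 2 * f 4 ^ 2 * g 0 ^ 2 + f 0 * f 1 ^ 3 * g 0 * g 5 - f 0 * f 1 ^ 3 * g 1 * g 4 -
      4 * f 0 * f 1 ^ 2 * f 2 * g 0 * g 4 + f 0 * f 1 ^ 2 * f 2 * g 1 * g 3 +
      f 0 * f 1 ^ 2 * f 3 * g 1 * g 2 + f 0 * f 1 ^ 2 * f 4 * g 1 ^ 2 +
      f 0 * f 1 ^ 2 * f 5 * g 0 * g 1 + 3 * f 0 * f 1 * f 2 ^ 2 * g 0 * g 3 -
      f 0 * f 1 * f 2 ^ 2 * g 1 * g 2 + 2 * f 0 * f 1 * f 2 * f 3 * g 0 * g 2 -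
      2 * f 0 * f 1 * f 2 * f 3 * g 1 ^ 2 + 2 * f 0 * f 1 * f 2 * f 5 * g 0 ^ 2 -
      2 * f 0 * f 1 * f 3 ^ 2 * g 0 * g 1 - 2 * f 0 * f 1 * f 3 * f 4 * g 0 ^ 2 -
      2 * f 0 * f 2 ^ 3 * g 0 * g 2 + f 0 * f 2 ^ 3 * g 1 ^ 2 +
      f 0 * f 2 ^ 2 * f 3 * g 0 * g 1 - 2 * f 0 * f 2 ^ 2 * f 4 * g 0 ^ 2 +
      2 * f 0 * f 2 * f 3 ^ 2 * g 0 ^ 2 + f 1 ^ 4 * g 0 * g 4 - f 1 ^ 3 * f 2 * g 0 * g 3 -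
      f 1 ^ 3 * f 3 * g 0 * g 2 - f 1 ^ 3 * f 4 * g 0 * g 1 - f 1 ^ 3 * f 5 * g 0 ^ 2 +
      f 1 ^ 2 * f 2 ^ 2 * g 0 * g 2 + 2 * f 1 ^ 2 * f 2 * f 3 * g 0 * g 1 +
      2 * f 1 ^ 2 * f 2 * f 4 * g 0 ^ 2 + f 1 ^ 2 * f 3 ^ 2 * g 0 ^ 2 -
      f 1 * f 2 ^ 3 * g 0 * g 1 - 3 * f 1 * f 2 ^ 2 * f 3 * g 0 ^ 2 + f 2 ^ 4 * g 0 ^ 2 := by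
  have hM : shiftDet 4 f g = Matrix.det
      !![0, 0, 0, f 0, g 0, 0;
        0, 0, f 0, f 1, g 1, g 0;
        0, f 0, f 1, f 2, g 2, g 1;
        f 0, f 1, f 2, f 3, g 3, g 2;
        f 1, f 2, f 3, f 4, g 4, g 3;
        f 2, f 3, f 4, f 5, g 5, g 4] := by
    unfold shiftDet natDet
    congr 1
    ext i j
    fin_cases i <;> fin_cases j <;> rfl
  rw [hM]
  simp [Matrix.det_succ_row_zero, Fin.sum_univ_succ, Fin.succAbove]
  ring

lemma shiftDet_five (f g : ℕ → ℚ) : shiftDet 5 f g =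
    f 0 ^ 5 * g 5 - f 0 ^ 4 * f 1 * g 4 - f 0 ^ 4 * f 2 * g 3 - f 0 ^ 4 * f 3 * g 2 -
      f 0 ^ 4 * f 4 * g 1 - f 0 ^ 4 * f 5 * g 0 + f 0 ^ 3 * f 1 ^ 2 * g 3 +
      2 * f 0 ^ 3 * f 1 * f 2 * g 2 + 2 * f 0 ^ 3 * f 1 * f 3 * g 1 +
      2 * f 0 ^ 3 * f 1 * f 4 * g 0 + f 0 ^ 3 * f 2 ^ 2 * g 1 +
      2 * f 0 ^ 3 * f 2 * f 3 * g 0 - f 0 ^ 2 * f 1 ^ 3 * g 2 -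
      3 * f 0 ^ 2 * f 1 ^ 2 * f 2 * g 1 - 3 * f 0 ^ 2 * f 1 ^ 2 * f 3 * g 0 -
      3 * f 0 ^ 2 * f 1 * f 2 ^ 2 * g 0 + f 0 * f 1 ^ 4 * g 1 +
      4 * f 0 * f 1 ^ 3 * f 2 * g 0 - f 1 ^ 5 * g 0 := by
  have hM : shiftDet 5 f g = Matrix.det
      !![0, 0, 0, 0, f 0, g 0;
        0, 0, 0, f 0, f 1, g 1;
        0, 0, f 0, f 1, f 2, g 2;
        0, f 0, f 1, f 2, f 3, g 3;
        f 0, f 1, f 2, f 3, f 4, g 4;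
        f 1, f 2, f 3, f 4, f 5, g 5] := by
    unfold shiftDet natDet
    congr 1
    ext i j
    fin_cases i <;> fin_cases j <;> rfl
  rw [hM]
  simp [Matrix.det_succ_row_zero, Fin.sum_univ_succ, Fin.succAbove]
  ring

lemma shiftDet_six (f g : ℕ → ℚ) : shiftDet 6 f g =
    -f 0 ^ 6 := by
  have hM : shiftDet 6 f g = Matrix.det
      !![0, 0, 0, 0, 0, f 0;
        0, 0, 0, 0, f 0, f 1;
        0, 0, 0, f 0, f 1, f 2;
        0, 0, f 0, f 1, f 2, f 3;
        0, f 0, f 1, f 2, f 3, f 4;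
        f 0, f 1, f 2, f 3, f 4, f 5] := by
    unfold shiftDet natDet
    congr 1
    ext i j
    fin_cases i <;> fin_cases j <;> rfl
  rw [hM]
  simp [Matrix.det_succ_row_zero, Fin.sum_univ_succ, Fin.succAbove]
  ring

/-! ### Low coefficients of the orthogonal polynomials. -/

lemma motzkinOrtho_coeff_add_two_zero (n : ℕ) : (motzkinOrtho (n + 2)).coeff 0 =
    -(motzkinOrtho (n + 1)).coeff 0 - (motzkinOrtho n).coeff 0 := by
  rw [motzkinOrtho_add_two, sub_mul, one_mul, coeff_sub, coeff_sub, mul_coeff_zero, coeff_X_zero]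
  ring

lemma motzkinOrtho_coeff_add_two_succ (n i : ℕ) : (motzkinOrtho (n + 2)).coeff (i + 1) =
    (motzkinOrtho (n + 1)).coeff i - (motzkinOrtho (n + 1)).coeff (i + 1) -
      (motzkinOrtho n).coeff (i + 1) := by
  rw [motzkinOrtho_add_two, sub_mul, one_mul, coeff_sub, coeff_sub, coeff_X_mul]

/-- The first six coefficients of `p` agree with the given values. -/
def LowCoeffs (p : ℚ[X]) (c₀ c₁ c₂ c₃ c₄ c₅ : ℚ) : Prop :=
  p.coeff 0 = c₀ ∧ p.coeff 1 = c₁ ∧ p.coeff 2 = c₂ ∧ p.coeff 3 = c₃ ∧ p.coeff 4 = c₄ ∧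
    p.coeff 5 = c₅

lemma LowCoeffs.step {n : ℕ} {a₀ a₁ a₂ a₃ a₄ a₅ b₀ b₁ b₂ b₃ b₄ b₅ : ℚ}
    (ha : LowCoeffs (motzkinOrtho n) a₀ a₁ a₂ a₃ a₄ a₅)
    (hb : LowCoeffs (motzkinOrtho (n + 1)) b₀ b₁ b₂ b₃ b₄ b₅) :
    LowCoeffs (motzkinOrtho (n + 2)) (-b₀ - a₀) (b₀ - b₁ - a₁) (b₁ - b₂ - a₂) (b₂ - b₃ - a₃)
      (b₃ - b₄ - a₄) (b₄ - b₅ - a₅) := by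
  obtain ⟨ha0, ha1, ha2, ha3, ha4, ha5⟩ := ha
  obtain ⟨hb0, hb1, hb2, hb3, hb4, hb5⟩ := hb
  refine ⟨?_, ?_, ?_, ?_, ?_, ?_⟩
  · rw [motzkinOrtho_coeff_add_two_zero, ha0, hb0]
  · rw [motzkinOrtho_coeff_add_two_succ, ha1, hb0, hb1]
  · rw [motzkinOrtho_coeff_add_two_succ, ha2, hb1, hb2]
  · rw [motzkinOrtho_coeff_add_two_succ, ha3, hb2, hb3]
  · rw [motzkinOrtho_coeff_add_two_succ, ha4, hb3, hb4]
  · rw [motzkinOrtho_coeff_add_two_succ, ha5, hb4, hb5]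

lemma LowCoeffs.congr {p : ℚ[X]} {a₀ a₁ a₂ a₃ a₄ a₅ b₀ b₁ b₂ b₃ b₄ b₅ : ℚ}
    (h : LowCoeffs p a₀ a₁ a₂ a₃ a₄ a₅) (h0 : a₀ = b₀) (h1 : a₁ = b₁) (h2 : a₂ = b₂)
    (h3 : a₃ = b₃) (h4 : a₄ = b₄) (h5 : a₅ = b₅) : LowCoeffs p b₀ b₁ b₂ b₃ b₄ b₅ := by
  subst h0 h1 h2 h3 h4 h5
  exact h

/-- Two consecutive classes modulo 3 determine the second-order recurrence, so they form the
induction state; passing from `k` to `k + 1` takes three recurrence steps. -/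
lemma lowCoeffs_motzkinOrtho (k : ℕ) :
    LowCoeffs (motzkinOrtho (3 * k))
      (1)
      ((k : ℚ))
      (-3 / 2 * (k : ℚ) ^ 2 - 3 / 2 * (k : ℚ))
      (-1 / 2 * (k : ℚ) ^ 3 + 1 / 2 * (k : ℚ) ^ 2 + (k : ℚ))
      (3 / 8 * (k : ℚ) ^ 4 + 11 / 12 * (k : ℚ) ^ 3 - 3 / 8 * (k : ℚ) ^ 2 - 11 / 12 * (k : ℚ))
      (3 / 40 * (k : ℚ) ^ 5 - 1 / 4 * (k : ℚ) ^ 4 - 7 / 8 * (k : ℚ) ^ 3 + 1 / 4 * (k : ℚ) ^ 2 +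
        4 / 5 * (k : ℚ)) ∧
    LowCoeffs (motzkinOrtho (3 * k + 1))
      (-1)
      ((k : ℚ) + 1)
      (3 / 2 * (k : ℚ) ^ 2 + 3 / 2 * (k : ℚ))
      (-1 / 2 * (k : ℚ) ^ 3 - 2 * (k : ℚ) ^ 2 - 3 / 2 * (k : ℚ))
      (-3 / 8 * (k : ℚ) ^ 4 - 7 / 12 * (k : ℚ) ^ 3 + 7 / 8 * (k : ℚ) ^ 2 + 13 / 12 * (k : ℚ))
      (3 / 40 * (k : ℚ) ^ 5 + 5 / 8 * (k : ℚ) ^ 4 + 7 / 8 * (k : ℚ) ^ 3 - 5 / 8 * (k : ℚ) ^ 2 -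
        19 / 20 * (k : ℚ)) := by
  induction k with
  | zero =>
    constructor <;> refine ⟨?_, ?_, ?_, ?_, ?_, ?_⟩ <;>
      simp [motzkinOrtho, coeff_one, coeff_X]
  | succ k ih =>
    obtain ⟨h0, h1⟩ := ih
    have h2 := h0.step h1
    have h3 := h1.step h2
    have h4 := h2.step h3
    constructor
    · refine h3.congr ?_ ?_ ?_ ?_ ?_ ?_ <;> push_cast <;> ring
    · refine h4.congr ?_ ?_ ?_ ?_ ?_ ?_ <;> push_cast <;> ring

lemma lowCoeffs_six (n : ℕ) :
    LowCoeffs (motzkinOrtho (21 * n + 6))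
      (1)
      (7 * (n : ℚ) + 2)
      (-147 / 2 * (n : ℚ) ^ 2 - 105 / 2 * (n : ℚ) - 9)
      (-343 / 2 * (n : ℚ) ^ 3 - 245 / 2 * (n : ℚ) ^ 2 - 21 * (n : ℚ))
      (7203 / 8 * (n : ℚ) ^ 4 + 16121 / 12 * (n : ℚ) ^ 3 + 5537 / 8 * (n : ℚ) ^ 2 +
        1729 / 12 * (n : ℚ) + 10)
      (50421 / 40 * (n : ℚ) ^ 5 + 2401 / 2 * (n : ℚ) ^ 4 + 343 / 8 * (n : ℚ) ^ 3 -
        245 * (n : ℚ) ^ 2 - 749 / 10 * (n : ℚ) - 6) := by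
  rw [show 21 * n + 6 = 3 * (7 * n + 2) by ring]
  refine LowCoeffs.congr (lowCoeffs_motzkinOrtho (7 * n + 2)).1 ?_ ?_ ?_ ?_ ?_ ?_ <;>
    push_cast <;> ring

lemma lowCoeffs_thirteen (n : ℕ) :
    LowCoeffs (motzkinOrtho (21 * n + 13))
      (-1)
      (7 * (n : ℚ) + 5)
      (147 / 2 * (n : ℚ) ^ 2 + 189 / 2 * (n : ℚ) + 30)
      (-343 / 2 * (n : ℚ) ^ 3 - 392 * (n : ℚ) ^ 2 - 581 / 2 * (n : ℚ) - 70)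
      (-7203 / 8 * (n : ℚ) ^ 4 - 27097 / 12 * (n : ℚ) ^ 3 - 16513 / 8 * (n : ℚ) ^ 2 -
        9737 / 12 * (n : ℚ) - 115)
      (50421 / 40 * (n : ℚ) ^ 5 + 40817 / 8 * (n : ℚ) ^ 4 + 62769 / 8 * (n : ℚ) ^ 3 +
        46207 / 8 * (n : ℚ) ^ 2 + 40887 / 20 * (n : ℚ) + 279) := by
  rw [show 21 * n + 13 = 3 * (7 * n + 4) + 1 by ring]
  refine LowCoeffs.congr (lowCoeffs_motzkinOrtho (7 * n + 4)).2 ?_ ?_ ?_ ?_ ?_ ?_ <;>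
    push_cast <;> ring

lemma lowCoeffs_twenty (n : ℕ) :
    LowCoeffs (motzkinOrtho (21 * n + 20))
      (0)
      (-14 * (n : ℚ) - 14)
      (7 * (n : ℚ) + 7)
      (343 * (n : ℚ) ^ 3 + 1029 * (n : ℚ) ^ 2 + 1022 * (n : ℚ) + 336)
      (-1715 / 6 * (n : ℚ) ^ 3 - 1715 / 2 * (n : ℚ) ^ 2 - 2555 / 3 * (n : ℚ) - 280)
      (-50421 / 20 * (n : ℚ) ^ 5 - 50421 / 4 * (n : ℚ) ^ 4 - 298753 / 12 * (n : ℚ) ^ 3 -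
        97069 / 4 * (n : ℚ) ^ 2 - 350021 / 30 * (n : ℚ) - 2212) := by
  rw [show 21 * n + 20 = 3 * (7 * n + 6) + 2 by ring]
  -- The class 2 modulo 3 has no closed form above; it is one recurrence step from the other two.
  refine LowCoeffs.congr ((lowCoeffs_motzkinOrtho (7 * n + 6)).1.step (lowCoeffs_motzkinOrtho (7 * n + 6)).2) ?_ ?_ ?_ ?_ ?_ ?_ <;>
    push_cast <;> ring

lemma lowCoeffs_twentySeven (n : ℕ) :
    LowCoeffs (motzkinOrtho (21 * n + 27))
      (1)
      (7 * (n : ℚ) + 9)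
      (-147 / 2 * (n : ℚ) ^ 2 - 399 / 2 * (n : ℚ) - 135)
      (-343 / 2 * (n : ℚ) ^ 3 - 637 * (n : ℚ) ^ 2 - 1561 / 2 * (n : ℚ) - 315)
      (7203 / 8 * (n : ℚ) ^ 4 + 59339 / 12 * (n : ℚ) ^ 3 + 80997 / 8 * (n : ℚ) ^ 2 +
        109921 / 12 * (n : ℚ) + 3090)
      (50421 / 40 * (n : ℚ) ^ 5 + 60025 / 8 * (n : ℚ) ^ 4 + 139601 / 8 * (n : ℚ) ^ 3 +
        157535 / 8 * (n : ℚ) ^ 2 + 213367 / 20 * (n : ℚ) + 2178) := by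
  rw [show 21 * n + 27 = 3 * (7 * n + 9) by ring]
  refine LowCoeffs.congr (lowCoeffs_motzkinOrtho (7 * n + 9)).1 ?_ ?_ ?_ ?_ ?_ ?_ <;>
    push_cast <;> ring

/-! ### Evaluation of the Hankel determinants in each class modulo 21. -/

lemma hankelDet_eq_shiftDet {a N n t : ℕ} (ha : a ≤ 6) (hN : N + a = 21 * n + 7 * t + 7) :
    hankelDet (motzkinSeries ^ 7) N = (-1) ^ n * ((-1) ^ (t + 1) *
      shiftDet a (motzkinOrtho (21 * n + (7 * t + 6))).coeff
        (motzkinOrtho (21 * n + (7 * t + 13))).coeff) := by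
  -- The sign `(-1) ^ (3 * n)` collapses to `(-1) ^ n`.
  rw [hankelDet_motzkinSeries_pow_seven (m := 3 * n + t) ha (by omega), natDet_kernelColumn,
    show 7 * (3 * n + t) + 6 = 21 * n + (7 * t + 6) by ring,
    show 7 * (3 * n + t) + 13 = 21 * n + (7 * t + 13) by ring, add_assoc, pow_add, pow_mul,
    ← mul_assoc]
  norm_num

lemma hankelDet_mul_succ (n : ℕ) :
    hankelDet (motzkinSeries ^ 7) (21 * n + 21) = (-1 : ℚ) ^ (n + 1) := by
  obtain ⟨hf0, hf1, hf2, hf3, hf4, hf5⟩ := lowCoeffs_twenty n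
  obtain ⟨hg0, hg1, hg2, hg3, hg4, hg5⟩ := lowCoeffs_twentySeven n
  rw [hankelDet_eq_shiftDet (a := 0) (n := n) (t := 2) (by norm_num) (by ring), shiftDet_zero]
  norm_num only [hf0, hf1, hf2, hf3, hf4, hf5, hg0, hg1, hg2, hg3, hg4, hg5]
  ring

lemma hankelDet_residue_1 (n : ℕ) :
    hankelDet (motzkinSeries ^ 7) (21 * n + 1) = (-1 : ℚ) ^ n := by
  obtain ⟨hf0, hf1, hf2, hf3, hf4, hf5⟩ := lowCoeffs_six n
  obtain ⟨hg0, hg1, hg2, hg3, hg4, hg5⟩ := lowCoeffs_thirteen n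
  rw [hankelDet_eq_shiftDet (a := 6) (n := n) (t := 0) (by norm_num) (by ring), shiftDet_six]
  norm_num only [hf0, hf1, hf2, hf3, hf4, hf5, hg0, hg1, hg2, hg3, hg4, hg5]
  ring

lemma hankelDet_residue_2 (n : ℕ) :
    hankelDet (motzkinSeries ^ 7) (21 * n + 2) =
      (-1 : ℚ) ^ (n + 1) * (7 / 30) * (2 * (n : ℚ) + 1) * (374556 * (n : ℚ) ^ 4 +
      385532 * (n : ℚ) ^ 3 + 127449 * (n : ℚ) ^ 2 + 13363 * (n : ℚ) + 60) := by
  obtain ⟨hf0, hf1, hf2, hf3, hf4, hf5⟩ := lowCoeffs_six n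
  obtain ⟨hg0, hg1, hg2, hg3, hg4, hg5⟩ := lowCoeffs_thirteen n
  rw [hankelDet_eq_shiftDet (a := 5) (n := n) (t := 0) (by norm_num) (by ring), shiftDet_five]
  norm_num only [hf0, hf1, hf2, hf3, hf4, hf5, hg0, hg1, hg2, hg3, hg4, hg5]
  ring

lemma hankelDet_residue_3 (n : ℕ) :
    hankelDet (motzkinSeries ^ 7) (21 * n + 3) =
      (-1 : ℚ) ^ n * (49 / 180) * (29647548 * (n : ℚ) ^ 6 + 54252996 * (n : ℚ) ^ 5 +
      27993259 * (n : ℚ) ^ 4 + 2344748 * (n : ℚ) ^ 3 - 1393217 * (n : ℚ) ^ 2 -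
      227934 * (n : ℚ) - 1080) * (2 * (n : ℚ) + 1) ^ 2 := by
  obtain ⟨hf0, hf1, hf2, hf3, hf4, hf5⟩ := lowCoeffs_six n
  obtain ⟨hg0, hg1, hg2, hg3, hg4, hg5⟩ := lowCoeffs_thirteen n
  rw [hankelDet_eq_shiftDet (a := 4) (n := n) (t := 0) (by norm_num) (by ring), shiftDet_four]
  norm_num only [hf0, hf1, hf2, hf3, hf4, hf5, hg0, hg1, hg2, hg3, hg4, hg5]
  ring

lemma hankelDet_residue_4 (n : ℕ) :
    hankelDet (motzkinSeries ^ 7) (21 * n + 4) =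
      (-1 : ℚ) ^ (n + 1) * (343 / 180) * (2 * (n : ℚ) + 1) ^ 3 * (4235364 * (n : ℚ) ^ 6 +
      12706092 * (n : ℚ) ^ 5 + 12161065 * (n : ℚ) ^ 4 + 3145310 * (n : ℚ) ^ 3 -
      906059 * (n : ℚ) ^ 2 - 361032 * (n : ℚ) + 3420) := by
  obtain ⟨hf0, hf1, hf2, hf3, hf4, hf5⟩ := lowCoeffs_six n
  obtain ⟨hg0, hg1, hg2, hg3, hg4, hg5⟩ := lowCoeffs_thirteen n
  rw [hankelDet_eq_shiftDet (a := 3) (n := n) (t := 0) (by norm_num) (by ring), shiftDet_three]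
  norm_num only [hf0, hf1, hf2, hf3, hf4, hf5, hg0, hg1, hg2, hg3, hg4, hg5]
  ring

lemma hankelDet_residue_5 (n : ℕ) :
    hankelDet (motzkinSeries ^ 7) (21 * n + 5) =
      (-1 : ℚ) ^ (n + 1) * (49 / 180) * (29647548 * (n : ℚ) ^ 6 + 123632292 * (n : ℚ) ^ 5 +
      201441499 * (n : ℚ) ^ 4 + 160049288 * (n : ℚ) ^ 3 + 61715353 * (n : ℚ) ^ 2 +
      9000600 * (n : ℚ) - 123300) * (2 * (n : ℚ) + 1) ^ 2 := by
  obtain ⟨hf0, hf1, hf2, hf3, hf4, hf5⟩ := lowCoeffs_six n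
  obtain ⟨hg0, hg1, hg2, hg3, hg4, hg5⟩ := lowCoeffs_thirteen n
  rw [hankelDet_eq_shiftDet (a := 2) (n := n) (t := 0) (by norm_num) (by ring), shiftDet_two]
  norm_num only [hf0, hf1, hf2, hf3, hf4, hf5, hg0, hg1, hg2, hg3, hg4, hg5]
  ring

lemma hankelDet_residue_6 (n : ℕ) :
    hankelDet (motzkinSeries ^ 7) (21 * n + 6) =
      (-1 : ℚ) ^ (n + 1) * (7 / 30) * (374556 * (n : ℚ) ^ 4 + 1112692 * (n : ℚ) ^ 3 +
      1218189 * (n : ℚ) ^ 2 + 583163 * (n : ℚ) + 103170) * (2 * (n : ℚ) + 1) := by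
  obtain ⟨hf0, hf1, hf2, hf3, hf4, hf5⟩ := lowCoeffs_six n
  obtain ⟨hg0, hg1, hg2, hg3, hg4, hg5⟩ := lowCoeffs_thirteen n
  rw [hankelDet_eq_shiftDet (a := 1) (n := n) (t := 0) (by norm_num) (by ring), shiftDet_one]
  norm_num only [hf0, hf1, hf2, hf3, hf4, hf5, hg0, hg1, hg2, hg3, hg4, hg5]
  ring

lemma hankelDet_residue_7 (n : ℕ) :
    hankelDet (motzkinSeries ^ 7) (21 * n + 7) = (-1 : ℚ) ^ (n + 1) := by
  obtain ⟨hf0, hf1, hf2, hf3, hf4, hf5⟩ := lowCoeffs_six n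
  obtain ⟨hg0, hg1, hg2, hg3, hg4, hg5⟩ := lowCoeffs_thirteen n
  rw [hankelDet_eq_shiftDet (a := 0) (n := n) (t := 0) (by norm_num) (by ring), shiftDet_zero]
  norm_num only [hf0, hf1, hf2, hf3, hf4, hf5, hg0, hg1, hg2, hg3, hg4, hg5]
  ring

lemma hankelDet_residue_8 (n : ℕ) :
    hankelDet (motzkinSeries ^ 7) (21 * n + 8) = (-1 : ℚ) ^ (n + 1) := by
  obtain ⟨hf0, hf1, hf2, hf3, hf4, hf5⟩ := lowCoeffs_thirteen n
  obtain ⟨hg0, hg1, hg2, hg3, hg4, hg5⟩ := lowCoeffs_twenty n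
  rw [hankelDet_eq_shiftDet (a := 6) (n := n) (t := 1) (by norm_num) (by ring), shiftDet_six]
  norm_num only [hf0, hf1, hf2, hf3, hf4, hf5, hg0, hg1, hg2, hg3, hg4, hg5]
  ring

lemma hankelDet_residue_9 (n : ℕ) :
    hankelDet (motzkinSeries ^ 7) (21 * n + 9) =
      (-1 : ℚ) ^ n * (7 / 30) * ((n : ℚ) + 1) * (749112 * (n : ℚ) ^ 4 +
      1850828 * (n : ℚ) ^ 3 + 1698242 * (n : ℚ) ^ 2 + 686273 * (n : ℚ) + 103230) := by
  obtain ⟨hf0, hf1, hf2, hf3, hf4, hf5⟩ := lowCoeffs_thirteen n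
  obtain ⟨hg0, hg1, hg2, hg3, hg4, hg5⟩ := lowCoeffs_twenty n
  rw [hankelDet_eq_shiftDet (a := 5) (n := n) (t := 1) (by norm_num) (by ring), shiftDet_five]
  norm_num only [hf0, hf1, hf2, hf3, hf4, hf5, hg0, hg1, hg2, hg3, hg4, hg5]
  ring

lemma hankelDet_residue_10 (n : ℕ) :
    hankelDet (motzkinSeries ^ 7) (21 * n + 10) =
      (-1 : ℚ) ^ (n + 1) * (49 / 180) * ((n : ℚ) + 1) ^ 2 * (118590192 * (n : ℚ) ^ 6 +
      375938976 * (n : ℚ) ^ 5 + 459474568 * (n : ℚ) ^ 4 + 261223312 * (n : ℚ) ^ 3 +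
      59779951 * (n : ℚ) ^ 2 - 1682814 * (n : ℚ) - 1959840) := by
  obtain ⟨hf0, hf1, hf2, hf3, hf4, hf5⟩ := lowCoeffs_thirteen n
  obtain ⟨hg0, hg1, hg2, hg3, hg4, hg5⟩ := lowCoeffs_twenty n
  rw [hankelDet_eq_shiftDet (a := 4) (n := n) (t := 1) (by norm_num) (by ring), shiftDet_four]
  norm_num only [hf0, hf1, hf2, hf3, hf4, hf5, hg0, hg1, hg2, hg3, hg4, hg5]
  ring

lemma hankelDet_residue_11 (n : ℕ) :
    hankelDet (motzkinSeries ^ 7) (21 * n + 11) =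
      (-1 : ℚ) ^ n * (343 / 90) * ((n : ℚ) + 1) ^ 3 * (16941456 * (n : ℚ) ^ 6 +
      84707280 * (n : ℚ) ^ 5 + 148881208 * (n : ℚ) ^ 4 + 115228792 * (n : ℚ) ^ 3 +
      34672057 * (n : ℚ) ^ 2 - 1047963 * (n : ℚ) - 1697400) := by
  obtain ⟨hf0, hf1, hf2, hf3, hf4, hf5⟩ := lowCoeffs_thirteen n
  obtain ⟨hg0, hg1, hg2, hg3, hg4, hg5⟩ := lowCoeffs_twenty n
  rw [hankelDet_eq_shiftDet (a := 3) (n := n) (t := 1) (by norm_num) (by ring), shiftDet_three]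
  norm_num only [hf0, hf1, hf2, hf3, hf4, hf5, hg0, hg1, hg2, hg3, hg4, hg5]
  ring

lemma hankelDet_residue_12 (n : ℕ) :
    hankelDet (motzkinSeries ^ 7) (21 * n + 12) =
      (-1 : ℚ) ^ n * (2401 / 15) * ((n : ℚ) + 1) ^ 4 * (115248 * (n : ℚ) ^ 4 +
      460992 * (n : ℚ) ^ 3 + 587608 * (n : ℚ) ^ 2 + 288512 * (n : ℚ) + 43695) := by
  obtain ⟨hf0, hf1, hf2, hf3, hf4, hf5⟩ := lowCoeffs_thirteen n
  obtain ⟨hg0, hg1, hg2, hg3, hg4, hg5⟩ := lowCoeffs_twenty n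
  rw [hankelDet_eq_shiftDet (a := 2) (n := n) (t := 1) (by norm_num) (by ring), shiftDet_two]
  norm_num only [hf0, hf1, hf2, hf3, hf4, hf5, hg0, hg1, hg2, hg3, hg4, hg5]
  ring

lemma hankelDet_residue_13 (n : ℕ) :
    hankelDet (motzkinSeries ^ 7) (21 * n + 13) = (-1 : ℚ) ^ n * 537824 * ((n : ℚ) + 1) ^ 5 := by
  obtain ⟨hf0, hf1, hf2, hf3, hf4, hf5⟩ := lowCoeffs_thirteen n
  obtain ⟨hg0, hg1, hg2, hg3, hg4, hg5⟩ := lowCoeffs_twenty n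
  rw [hankelDet_eq_shiftDet (a := 1) (n := n) (t := 1) (by norm_num) (by ring), shiftDet_one]
  norm_num only [hf0, hf1, hf2, hf3, hf4, hf5, hg0, hg1, hg2, hg3, hg4, hg5]
  ring

/-- The vanishing here and in the next class comes from `p_{21n+20}(0) = 0`: at these two sizes the
6 × 6 determinant is, up to sign, the sixth power of that value. -/
lemma hankelDet_residue_14 (n : ℕ) :
    hankelDet (motzkinSeries ^ 7) (21 * n + 14) = 0 := by
  obtain ⟨hf0, hf1, hf2, hf3, hf4, hf5⟩ := lowCoeffs_thirteen n
  obtain ⟨hg0, hg1, hg2, hg3, hg4, hg5⟩ := lowCoeffs_twenty n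
  rw [hankelDet_eq_shiftDet (a := 0) (n := n) (t := 1) (by norm_num) (by ring), shiftDet_zero]
  norm_num only [hf0, hf1, hf2, hf3, hf4, hf5, hg0, hg1, hg2, hg3, hg4, hg5]
  ring

lemma hankelDet_residue_15 (n : ℕ) :
    hankelDet (motzkinSeries ^ 7) (21 * n + 15) = 0 := by
  obtain ⟨hf0, hf1, hf2, hf3, hf4, hf5⟩ := lowCoeffs_twenty n
  obtain ⟨hg0, hg1, hg2, hg3, hg4, hg5⟩ := lowCoeffs_twentySeven n
  rw [hankelDet_eq_shiftDet (a := 6) (n := n) (t := 2) (by norm_num) (by ring), shiftDet_six]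
  norm_num only [hf0, hf1, hf2, hf3, hf4, hf5, hg0, hg1, hg2, hg3, hg4, hg5]
  ring

lemma hankelDet_residue_16 (n : ℕ) :
    hankelDet (motzkinSeries ^ 7) (21 * n + 16) =
      (-1 : ℚ) ^ (n + 1) * 537824 * ((n : ℚ) + 1) ^ 5 := by
  obtain ⟨hf0, hf1, hf2, hf3, hf4, hf5⟩ := lowCoeffs_twenty n
  obtain ⟨hg0, hg1, hg2, hg3, hg4, hg5⟩ := lowCoeffs_twentySeven n
  rw [hankelDet_eq_shiftDet (a := 5) (n := n) (t := 2) (by norm_num) (by ring), shiftDet_five]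
  norm_num only [hf0, hf1, hf2, hf3, hf4, hf5, hg0, hg1, hg2, hg3, hg4, hg5]
  ring

lemma hankelDet_residue_17 (n : ℕ) :
    hankelDet (motzkinSeries ^ 7) (21 * n + 17) =
      (-1 : ℚ) ^ n * (2401 / 15) * ((n : ℚ) + 1) ^ 4 * (115248 * (n : ℚ) ^ 4 +
      460992 * (n : ℚ) ^ 3 + 587608 * (n : ℚ) ^ 2 + 217952 * (n : ℚ) - 26865) := by
  obtain ⟨hf0, hf1, hf2, hf3, hf4, hf5⟩ := lowCoeffs_twenty n
  obtain ⟨hg0, hg1, hg2, hg3, hg4, hg5⟩ := lowCoeffs_twentySeven n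
  rw [hankelDet_eq_shiftDet (a := 4) (n := n) (t := 2) (by norm_num) (by ring), shiftDet_four]
  norm_num only [hf0, hf1, hf2, hf3, hf4, hf5, hg0, hg1, hg2, hg3, hg4, hg5]
  ring

lemma hankelDet_residue_18 (n : ℕ) :
    hankelDet (motzkinSeries ^ 7) (21 * n + 18) =
      (-1 : ℚ) ^ (n + 1) * (343 / 90) * ((n : ℚ) + 1) ^ 3 * (16941456 * (n : ℚ) ^ 6 +
      118590192 * (n : ℚ) ^ 5 + 318295768 * (n : ℚ) ^ 4 + 398162632 * (n : ℚ) ^ 3 +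
      205815337 * (n : ℚ) ^ 2 - 2633505 * (n : ℚ) - 27024030) := by
  obtain ⟨hf0, hf1, hf2, hf3, hf4, hf5⟩ := lowCoeffs_twenty n
  obtain ⟨hg0, hg1, hg2, hg3, hg4, hg5⟩ := lowCoeffs_twentySeven n
  rw [hankelDet_eq_shiftDet (a := 3) (n := n) (t := 2) (by norm_num) (by ring), shiftDet_three]
  norm_num only [hf0, hf1, hf2, hf3, hf4, hf5, hg0, hg1, hg2, hg3, hg4, hg5]
  ring

lemma hankelDet_residue_19 (n : ℕ) :
    hankelDet (motzkinSeries ^ 7) (21 * n + 19) =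
      (-1 : ℚ) ^ (n + 1) * (49 / 180) * ((n : ℚ) + 1) ^ 2 * (118590192 * (n : ℚ) ^ 6 +
      1047143328 * (n : ℚ) ^ 5 + 3815496328 * (n : ℚ) ^ 4 + 7351444912 * (n : ℚ) ^ 3 +
      7906357711 * (n : ℚ) ^ 2 + 4503507834 * (n : ℚ) + 1062057240) := by
  obtain ⟨hf0, hf1, hf2, hf3, hf4, hf5⟩ := lowCoeffs_twenty n
  obtain ⟨hg0, hg1, hg2, hg3, hg4, hg5⟩ := lowCoeffs_twentySeven n
  rw [hankelDet_eq_shiftDet (a := 2) (n := n) (t := 2) (by norm_num) (by ring), shiftDet_two]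
  norm_num only [hf0, hf1, hf2, hf3, hf4, hf5, hg0, hg1, hg2, hg3, hg4, hg5]
  ring

lemma hankelDet_residue_20 (n : ℕ) :
    hankelDet (motzkinSeries ^ 7) (21 * n + 20) =
      (-1 : ℚ) ^ (n + 1) * (7 / 30) * ((n : ℚ) + 1) * (749112 * (n : ℚ) ^ 4 +
      4142068 * (n : ℚ) ^ 3 + 8571962 * (n : ℚ) ^ 2 + 7868343 * (n : ℚ) + 2702820) := by
  obtain ⟨hf0, hf1, hf2, hf3, hf4, hf5⟩ := lowCoeffs_twenty n
  obtain ⟨hg0, hg1, hg2, hg3, hg4, hg5⟩ := lowCoeffs_twentySeven n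
  rw [hankelDet_eq_shiftDet (a := 1) (n := n) (t := 2) (by norm_num) (by ring), shiftDet_one]
  norm_num only [hf0, hf1, hf2, hf3, hf4, hf5, hg0, hg1, hg2, hg3, hg4, hg5]
  ring

end Evaluation

theorem mainTheorem6 (n : ℕ) :
    hankelDet (motzkinSeries ^ 7) (21 * n) = (-1 : ℚ) ^ n ∧
    hankelDet (motzkinSeries ^ 7) (21 * n + 1) = (-1 : ℚ) ^ n ∧
    hankelDet (motzkinSeries ^ 7) (21 * n + 2) =
      (-1 : ℚ) ^ (n + 1) * (7 / 30) * (2 * (n : ℚ) + 1) * (374556 * (n : ℚ) ^ 4 +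
        385532 * (n : ℚ) ^ 3 + 127449 * (n : ℚ) ^ 2 + 13363 * (n : ℚ) + 60) ∧
    hankelDet (motzkinSeries ^ 7) (21 * n + 3) =
      (-1 : ℚ) ^ n * (49 / 180) * (29647548 * (n : ℚ) ^ 6 + 54252996 * (n : ℚ) ^ 5 +
        27993259 * (n : ℚ) ^ 4 + 2344748 * (n : ℚ) ^ 3 - 1393217 * (n : ℚ) ^ 2 -
        227934 * (n : ℚ) - 1080) * (2 * (n : ℚ) + 1) ^ 2 ∧
    hankelDet (motzkinSeries ^ 7) (21 * n + 4) =
      (-1 : ℚ) ^ (n + 1) * (343 / 180) * (2 * (n : ℚ) + 1) ^ 3 * (4235364 * (n : ℚ) ^ 6 +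
        12706092 * (n : ℚ) ^ 5 + 12161065 * (n : ℚ) ^ 4 + 3145310 * (n : ℚ) ^ 3 -
        906059 * (n : ℚ) ^ 2 - 361032 * (n : ℚ) + 3420) ∧
    hankelDet (motzkinSeries ^ 7) (21 * n + 5) =
      (-1 : ℚ) ^ (n + 1) * (49 / 180) * (29647548 * (n : ℚ) ^ 6 + 123632292 * (n : ℚ) ^ 5 +
        201441499 * (n : ℚ) ^ 4 + 160049288 * (n : ℚ) ^ 3 + 61715353 * (n : ℚ) ^ 2 +
        9000600 * (n : ℚ) - 123300) * (2 * (n : ℚ) + 1) ^ 2 ∧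
    hankelDet (motzkinSeries ^ 7) (21 * n + 6) =
      (-1 : ℚ) ^ (n + 1) * (7 / 30) * (374556 * (n : ℚ) ^ 4 + 1112692 * (n : ℚ) ^ 3 +
        1218189 * (n : ℚ) ^ 2 + 583163 * (n : ℚ) + 103170) * (2 * (n : ℚ) + 1) ∧
    hankelDet (motzkinSeries ^ 7) (21 * n + 7) = (-1 : ℚ) ^ (n + 1) ∧
    hankelDet (motzkinSeries ^ 7) (21 * n + 8) = (-1 : ℚ) ^ (n + 1) ∧
    hankelDet (motzkinSeries ^ 7) (21 * n + 9) =
      (-1 : ℚ) ^ n * (7 / 30) * ((n : ℚ) + 1) * (749112 * (n : ℚ) ^ 4 +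
        1850828 * (n : ℚ) ^ 3 + 1698242 * (n : ℚ) ^ 2 + 686273 * (n : ℚ) + 103230) ∧
    hankelDet (motzkinSeries ^ 7) (21 * n + 10) =
      (-1 : ℚ) ^ (n + 1) * (49 / 180) * ((n : ℚ) + 1) ^ 2 * (118590192 * (n : ℚ) ^ 6 +
        375938976 * (n : ℚ) ^ 5 + 459474568 * (n : ℚ) ^ 4 + 261223312 * (n : ℚ) ^ 3 +
        59779951 * (n : ℚ) ^ 2 - 1682814 * (n : ℚ) - 1959840) ∧
    hankelDet (motzkinSeries ^ 7) (21 * n + 11) =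
      (-1 : ℚ) ^ n * (343 / 90) * ((n : ℚ) + 1) ^ 3 * (16941456 * (n : ℚ) ^ 6 +
        84707280 * (n : ℚ) ^ 5 + 148881208 * (n : ℚ) ^ 4 + 115228792 * (n : ℚ) ^ 3 +
        34672057 * (n : ℚ) ^ 2 - 1047963 * (n : ℚ) - 1697400) ∧
    hankelDet (motzkinSeries ^ 7) (21 * n + 12) =
      (-1 : ℚ) ^ n * (2401 / 15) * ((n : ℚ) + 1) ^ 4 * (115248 * (n : ℚ) ^ 4 +
        460992 * (n : ℚ) ^ 3 + 587608 * (n : ℚ) ^ 2 + 288512 * (n : ℚ) + 43695) ∧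
    hankelDet (motzkinSeries ^ 7) (21 * n + 13) = (-1 : ℚ) ^ n * 537824 * ((n : ℚ) + 1) ^ 5 ∧
    hankelDet (motzkinSeries ^ 7) (21 * n + 14) = 0 ∧
    hankelDet (motzkinSeries ^ 7) (21 * n + 15) = 0 ∧
    hankelDet (motzkinSeries ^ 7) (21 * n + 16) =
      (-1 : ℚ) ^ (n + 1) * 537824 * ((n : ℚ) + 1) ^ 5 ∧
    hankelDet (motzkinSeries ^ 7) (21 * n + 17) =
      (-1 : ℚ) ^ n * (2401 / 15) * ((n : ℚ) + 1) ^ 4 * (115248 * (n : ℚ) ^ 4 +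
        460992 * (n : ℚ) ^ 3 + 587608 * (n : ℚ) ^ 2 + 217952 * (n : ℚ) - 26865) ∧
    hankelDet (motzkinSeries ^ 7) (21 * n + 18) =
      (-1 : ℚ) ^ (n + 1) * (343 / 90) * ((n : ℚ) + 1) ^ 3 * (16941456 * (n : ℚ) ^ 6 +
        118590192 * (n : ℚ) ^ 5 + 318295768 * (n : ℚ) ^ 4 + 398162632 * (n : ℚ) ^ 3 +
        205815337 * (n : ℚ) ^ 2 - 2633505 * (n : ℚ) - 27024030) ∧
    hankelDet (motzkinSeries ^ 7) (21 * n + 19) =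
      (-1 : ℚ) ^ (n + 1) * (49 / 180) * ((n : ℚ) + 1) ^ 2 * (118590192 * (n : ℚ) ^ 6 +
        1047143328 * (n : ℚ) ^ 5 + 3815496328 * (n : ℚ) ^ 4 + 7351444912 * (n : ℚ) ^ 3 +
        7906357711 * (n : ℚ) ^ 2 + 4503507834 * (n : ℚ) + 1062057240) ∧
    hankelDet (motzkinSeries ^ 7) (21 * n + 20) =
      (-1 : ℚ) ^ (n + 1) * (7 / 30) * ((n : ℚ) + 1) * (749112 * (n : ℚ) ^ 4 +
        4142068 * (n : ℚ) ^ 3 + 8571962 * (n : ℚ) ^ 2 + 7868343 * (n : ℚ) + 2702820) := by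
  refine ⟨?_, hankelDet_residue_1 n, hankelDet_residue_2 n, hankelDet_residue_3 n,
    hankelDet_residue_4 n, hankelDet_residue_5 n, hankelDet_residue_6 n, hankelDet_residue_7 n,
    hankelDet_residue_8 n, hankelDet_residue_9 n, hankelDet_residue_10 n, hankelDet_residue_11 n,
    hankelDet_residue_12 n, hankelDet_residue_13 n, hankelDet_residue_14 n, hankelDet_residue_15 n,
    hankelDet_residue_16 n, hankelDet_residue_17 n, hankelDet_residue_18 n,
    hankelDet_residue_19 n, hankelDet_residue_20 n⟩
  -- The reduction, with `a ≤ 6`, only reaches sizes `N ≥ 1`; the empty determinant is treated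
  -- separately.
  rcases n with _ | n
  · simp [hankelDet]
  · exact hankelDet_mul_succ n
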